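/- \textbf{Theorem.} The algorithm PLOS can be implemented in $O(1)$ rounds of communication. Precisely: fix an integer $k\ge 2$ and reals $\varepsilon>0$, $0<\beta\le 1/\sqrt2$, $0<\delta<\beta/4$. There are constants $R,b\in\mathbb N$, depending only on $k,\varepsilon,\beta,\delta$, such that for every $r$ with $0<r\le\varepsilon\delta/4$ and every rule $\sigma$ for dividing sectors into cones (see step 2) there is a single distributed algorithm which, on every finite network, terminates after $R$ rounds with each node knowing exactly its incident edges in a graph $H$ that is an output of PLOS (with these parameters) on that network. Each message consists of at most $b$ identifiers of nodes with their coordinates. \emph{Networks and communication.} A network is a finite set $V$ of distinct points (nodes) in the plane with distinct identifiers $\mathrm{ID}(v)\in\mathbb N$; $G=(V,E)$ is its unit disk graph: $uv\in E$ iff $u\ne v$ and $|uv|\le 1$. All nodes run the same program; at the start a node knows only its own identifier and coordinates. In each synchronous round every node sends finitely many messages to each of its neighbors in $G$, receives the messages sent to it, and performs arbitrary local computation. \emph{Edge identifiers and lengths.} $\mathrm{ID}(uv)$ is the lexicographically smaller of $(|uv|,\mathrm{ID}(u),\mathrm{ID}(v))$ and $(|uv|,\mathrm{ID}(v),\mathrm{ID}(u))$;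 edges are compared lexicographically. $|\mathrm{sp}_Q(u,v)|$ is the Euclidean length of a shortest $uv$-path in $Q$ ($\infty$ if there is none). \emph{PLOS.} \begin{enumerate} \item $\mathrm{LDel}$ is the $k$-localized Delaunay graph. It contains all Gabriel edges (edges $uv\in E$ such that the open disk with diameter $uv$ contains no node) and all sides of those nondegenerate triangles $abc$ with sides in $E$ whose circumcircle has no node within $k$ hops of $a$, $b$ or $c$ in its interior. For $(i,j)\in\mathbb Z^2$ and $s=\beta-2\delta$, the cell $(i,j)$ is $[is,is+\beta)\times[js,js+\beta)$, and $V_{ij}$ is the clique of nodes in it. \item For each cell let $G_{ij}=(V,E_{ij})$, where $E_{ij}$ is the set of edges of $\mathrm{LDel}$ incident to nodes in $V_{ij}$, and let $\mathrm{YDel}_{ij}$ be the ordered Yao graph of $G_{ij}$, obtained as follows. Repeatedly remove a node of smallest degree in the remaining graph (ties by smallest $\mathrm{ID}$), then process the nodes in the reverse order. When $u$ is processed, the rays from $u$ through its already processed neighbors divide the plane into sectors (a single sector, with an initial ray given by $\sigma$, if there are none). Each sector is divided, as given by $\sigma$, into the fewest open cones of angle at most $\pi/3$; $\sigma$ depends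 only on the positions of $u$ and of its processed and unprocessed neighbors, and on the sector. For each cone, with the neighbors $s_1,\dots,s_m$ of $u$ in it in angular order, the edge $us_i$ of smallest $\mathrm{ID}$ and all edges $s_js_{j+1}$ are selected. Set $\mathrm{YDel}=\bigcup_{i,j}\mathrm{YDel}_{ij}$. \item Start with $H$ having no edges. For $\kappa=0,1,2,3$, process one after the other, in any order, the nonempty cells with $2(i\bmod 2)+(j\bmod 2)=\kappa$: let $F$ be the set of edges of the current $\mathrm{YDel}$ with both endpoints in the cell, and $Q=\mathrm{YDel}\setminus F$. For each $uv\in F$, in increasing order of $\mathrm{ID}$, if $|\mathrm{sp}_Q(u,v)|>(1+\varepsilon)|uv|$ then add $uv$ to $H$ and $Q$, otherwise eliminate $uv$ from $\mathrm{YDel}$. \item Choose an $r$-cluster cover for $V$ in the current $\mathrm{YDel}$: disjoint clusters covering $V$, with centers such that each node of a cluster is at shortest-path distance at most $r$ from the center, and distinct centers are at shortest-path distance greater than $r$. Add to $H$ all edges of $\mathrm{YDel}$ that connect two centers. Output $H$. \end{enumerate} An output of PLOS is any graph $H$ that results for some processing order of the cells in each class of step 3 and some $r$-cluster cover in step 4.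 -/

import Mathlib

namespace PLOS

open scoped ENNReal

noncomputable section

universe u

/-! ### Wireless networks and their unit disk graphs -/

/-- A wireless network in the Euclidean plane (identified with `ℂ`): each node has a unique
identifier and a position, and distinct nodes have distinct positions. -/
structure Network (V : Type u) where
  ident : V → ℕ
  ident_injective : Function.Injective ident
  pos : V → ℂ
  pos_injective : Function.Injective pos

/-- What a node knows about itself at the start: its identifier and its coordinates. -/
structure NodeInfo where
  ident : ℕ
  pos : ℂ

namespace Network

variable {V : Type u} (N : Network V)

def info (v : V) : NodeInfo := ⟨N.ident v, N.pos v⟩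

/-- The Euclidean length `|uv|`. -/
def len (v w : V) : ℝ := dist (N.pos v) (N.pos w)

/-- The unit disk graph of the network. -/
def udg : SimpleGraph V where
  Adj v w := v ≠ w ∧ N.len v w ≤ 1
  symm := ⟨fun v w h => ⟨h.1.symm, by
    have h2 := h.2
    unfold len at h2 ⊢
    rwa [dist_comm]⟩⟩
  loopless := ⟨fun _ h => h.1 rfl⟩

/-- The Euclidean length of a walk. -/
def walkLength {H : SimpleGraph V} {v w : V} (p : H.Walk v w) : ℝ :=
  (p.darts.map fun d => N.len d.fst d.snd).sum

/-- `|sp_H(v, w)|`, the length of a shortest path in `H` (`∞` if there is none). -/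
def sp (H : SimpleGraph V) (v w : V) : ℝ≥0∞ :=
  ⨅ p : H.Walk v w, ENNReal.ofReal (N.walkLength p)

/-- The identifier of a directed edge; the order on identifiers is lexicographic. -/
def dirEdgeId (v w : V) : ℝ ×ₗ (ℕ ×ₗ ℕ) :=
  toLex (N.len v w, toLex (N.ident v, N.ident w))

/-- The identifier of an undirected edge. -/
def edgeId : Sym2 V → ℝ ×ₗ (ℕ ×ₗ ℕ) :=
  Sym2.lift ⟨fun v w => min (N.dirEdgeId v w) (N.dirEdgeId w v), fun _ _ => min_comm _ _⟩

/-! ### The localized Delaunay graph -/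

/-- `vw` is a Gabriel edge: `|vw| ≤ 1` and the open disk with diameter `vw` contains no node. -/
def IsGabrielEdge (v w : V) : Prop :=
  N.udg.Adj v w ∧
    ∀ x, N.pos x ∉ Metric.ball (midpoint ℝ (N.pos v) (N.pos w)) (N.len v w / 2)

/-- `abc` is a `k`-localized Delaunay triangle: its sides have length at most one, and the interior
of its circumcircle contains no node that is within `k` hops of `a`, `b` or `c`. -/
def IsLocalizedDelaunayTriangle (k : ℕ) (a b c : V) : Prop :=
  ¬ Collinear ℝ {N.pos a, N.pos b, N.pos c} ∧
  N.udg.Adj a b ∧ N.udg.Adj b c ∧ N.udg.Adj a c ∧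
  ∃ (o : ℂ) (ρ : ℝ), dist (N.pos a) o = ρ ∧ dist (N.pos b) o = ρ ∧ dist (N.pos c) o = ρ ∧
    ∀ x, (N.udg.edist a x ≤ k ∨ N.udg.edist b x ≤ k ∨ N.udg.edist c x ≤ k) →
      N.pos x ∉ Metric.ball o ρ

/-- The `k`-localized Delaunay graph: all Gabriel edges and all edges of `k`-localized Delaunay
triangles. -/
def ldel (k : ℕ) : SimpleGraph V :=
  SimpleGraph.fromRel fun v w =>
    N.IsGabrielEdge v w ∨ ∃ x, N.IsLocalizedDelaunayTriangle k v w x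

end Network

/-! ### The grid -/

/-- The grid cell with index `c = (i, j)`: a square of side `β`. The centers of adjacent cells are
at distance `β - 2δ`. -/
def cell (β δ : ℝ) (c : ℤ × ℤ) : Set ℂ :=
  {z | (c.1 : ℝ) * (β - 2 * δ) ≤ z.re ∧ z.re < c.1 * (β - 2 * δ) + β ∧
       (c.2 : ℝ) * (β - 2 * δ) ≤ z.im ∧ z.im < c.2 * (β - 2 * δ) + β}

/-- The class `(i mod 2) * 2 + (j mod 2) ∈ {0, 1, 2, 3}` of a cell. -/
def cellClass (c : ℤ × ℤ) : ℤ := (c.1 % 2) * 2 + c.2 % 2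

/-! ### The ordered Yao structure -/

/-- The counterclockwise angle, in `[0, 2π)`, from the direction `θ` to the direction of `z`. -/
def ccw (θ : ℝ) (z : ℂ) : ℝ := toIcoMod Real.two_pi_pos 0 (z.arg - θ)

/-- `ws` lists positive angles, each at most `π / 3`, that add up to `A`. -/
def IsDivision (A : ℝ) (ws : List ℝ) : Prop :=
  (∀ w ∈ ws, 0 < w ∧ w ≤ Real.pi / 3) ∧ ws.sum = A

/-- A rule that resolves the choices left open in dividing the plane around a node. Its arguments
are the position of the node and the sets of positions of its processed and of its unprocessed
neighbors. A sector with initial direction `θ` and angle `A` is divided, counterclockwise, into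
cones with the angles `widths p P U θ A`, which are as few as possible; if there is no processed
neighbor, then the whole plane is a single sector, with initial direction `start p U`. -/
structure ConeRule where
  start : ℂ → Set ℂ → ℝ
  widths : ℂ → Set ℂ → Set ℂ → ℝ → ℝ → List ℝ
  isDivision : ∀ p P U θ A, 0 < A → A ≤ 2 * Real.pi → IsDivision A (widths p P U θ A)
  fewest : ∀ p P U θ A, 0 < A → A ≤ 2 * Real.pi →
    ∀ ws, IsDivision A ws → (widths p P U θ A).length ≤ ws.length

section OrderedYao

variable {V : Type u} (N : Network V) (G : SimpleGraph V)

/-- `π` is the order found in the first part of the ordered Yao method. The nodes are removed one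
by one; a node removed in step `i` gets `π = n - i + 1`, so just before the removal of `v` the
remaining nodes are those `x` with `π x ≤ π v`, and `v` has the smallest degree among them in the
graph that they induce, ties being broken by smallest identifier. -/
def IsYaoOrder (π : V → ℕ) : Prop :=
  Function.Injective π ∧ (∀ v, π v ∈ Set.Icc 1 (Nat.card V)) ∧
  ∀ v w, π w ≤ π v →
    toLex ({x | π x ≤ π v ∧ G.Adj v x}.ncard, N.ident v) ≤
      toLex ({x | π x ≤ π v ∧ G.Adj w x}.ncard, N.ident w)

/-- The neighbors of `v` that are processed before `v`. -/
def processedNbrs (π : V → ℕ) (v : V) : Set V := {x | G.Adj v x ∧ π x < π v}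

/-- The neighbors of `v` that are unprocessed when `v` is processed. -/
def unprocessedNbrs (π : V → ℕ) (v : V) : Set V := {x | G.Adj v x ∧ π v < π x}

/-- The rays from `v` through its processed neighbors bound a sector at `v` with initial
direction `θ` and angle `A`. -/
def IsSector (rule : ConeRule) (π : V → ℕ) (v : V) (θ A : ℝ) : Prop :=
  (processedNbrs G π v = ∅ ∧
    θ = rule.start (N.pos v) (N.pos '' unprocessedNbrs G π v) ∧ A = 2 * Real.pi) ∨
  ∃ x ∈ processedNbrs G π v, θ = (N.pos x - N.pos v).arg ∧
    IsLeast ((fun y => toIocMod Real.two_pi_pos 0 ((N.pos y - N.pos v).arg - θ)) ''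
      processedNbrs G π v) A

/-- The open cone at `v` of the directions at counterclockwise angle between `lo` and `hi` from
`θ` is one of the cones into which the sectors at `v` are divided. -/
def IsYaoCone (rule : ConeRule) (π : V → ℕ) (v : V) (θ lo hi : ℝ) : Prop :=
  ∃ A, IsSector N G rule π v θ A ∧
    ∃ ws, ws = rule.widths (N.pos v) (N.pos '' processedNbrs G π v)
        (N.pos '' unprocessedNbrs G π v) θ A ∧
      ∃ j < ws.length, lo = (ws.take j).sum ∧ hi = (ws.take (j + 1)).sum

/-- The neighbors of `v` in an open cone. -/
def coneNbrs (v : V) (θ lo hi : ℝ) : Set V :=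
  {x | G.Adj v x ∧ lo < ccw θ (N.pos x - N.pos v) ∧ ccw θ (N.pos x - N.pos v) < hi}

/-- The graph built in the second part of the ordered Yao method: for each node `v` and each cone
at `v`, the shortest edge from `v` to a neighbor in the cone (the one of smallest identifier), and
the edges between neighbors of `v` in the cone that are consecutive in the angular order. -/
def yaoGraph (rule : ConeRule) (π : V → ℕ) : SimpleGraph V :=
  SimpleGraph.fromRel fun a b =>
    ∃ v θ lo hi, IsYaoCone N G rule π v θ lo hi ∧
      ((a = v ∧ b ∈ coneNbrs N G v θ lo hi ∧
          ∀ x ∈ coneNbrs N G v θ lo hi, N.edgeId s(v, b) ≤ N.edgeId s(v, x)) ∨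
        (a ∈ coneNbrs N G v θ lo hi ∧ b ∈ coneNbrs N G v θ lo hi ∧
          ccw θ (N.pos a - N.pos v) < ccw θ (N.pos b - N.pos v) ∧
          ∀ x ∈ coneNbrs N G v θ lo hi,
            ¬ (ccw θ (N.pos a - N.pos v) < ccw θ (N.pos x - N.pos v) ∧
               ccw θ (N.pos x - N.pos v) < ccw θ (N.pos b - N.pos v))))

/-- `G'` is the output of the ordered Yao method on `G`. -/
def IsOrderedYao (rule : ConeRule) (G' : SimpleGraph V) : Prop :=
  ∃ π, IsYaoOrder N G π ∧ G' = yaoGraph N G rule π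

end OrderedYao

/-! ### The algorithm PLOS -/

section Algorithm

variable {V : Type u} [Finite V] (N : Network V)

/-- `G_c`: the edges of the localized Delaunay graph incident to nodes in the cell `c`. -/
def incidentGraph (k : ℕ) (β δ : ℝ) (c : ℤ × ℤ) : SimpleGraph V :=
  SimpleGraph.fromRel fun v w => (N.ldel k).Adj v w ∧ N.pos v ∈ cell β δ c

/-- The edges of `Y` that lie in the cell `c`. -/
def cellEdges (β δ : ℝ) (c : ℤ × ℤ) (Y : SimpleGraph V) : Set (Sym2 V) :=
  {e | e ∈ Y.edgeSet ∧ ∀ x ∈ e, N.pos x ∈ cell β δ c}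

open Classical in
/-- The edges of `Y` that lie in the cell `c`, in increasing order of their identifiers. -/
def sortedCellEdges (β δ : ℝ) (c : ℤ × ℤ) (Y : SimpleGraph V) : List (Sym2 V) :=
  (cellEdges N β δ c Y).toFinite.toFinset.toList.mergeSort
    fun e f => decide (N.edgeId e ≤ N.edgeId f)

open Classical in
/-- The shortest path query for `e = vw`: if `|sp_Q(v, w)| > (1 + ε) |vw|`, then `e` is added to
`Q` and to `H`. The state is the pair `(Q, H)`. -/
def query (ε : ℝ) (S : SimpleGraph V × SimpleGraph V) (e : Sym2 V) :
    SimpleGraph V × SimpleGraph V :=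
  if ∃ v w, e = s(v, w) ∧ ENNReal.ofReal ((1 + ε) * N.len v w) < N.sp S.1 v w then
    (S.1 ⊔ SimpleGraph.fromEdgeSet {e}, S.2 ⊔ SimpleGraph.fromEdgeSet {e})
  else S

/-- The greedy filter on one cell. The state is the pair `(YDel, H)`. The query graph `Q` starts
as `YDel` without its edges in the cell. Since each of these edges is either added to `Q` or
eliminated from `YDel`, the new `YDel` is the final `Q`. -/
def processCell (ε β δ : ℝ) (S : SimpleGraph V × SimpleGraph V) (c : ℤ × ℤ) :
    SimpleGraph V × SimpleGraph V :=
  (sortedCellEdges N β δ c S.1).foldl (query N ε) (S.1.deleteEdges (cellEdges N β δ c S.1), S.2)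

/-- `cs` lists the cells that contain a node, each once, by increasing class. -/
def IsCellOrder (β δ : ℝ) (cs : List (ℤ × ℤ)) : Prop :=
  cs.Nodup ∧ (∀ c, c ∈ cs ↔ ∃ v, N.pos v ∈ cell β δ c) ∧
    cs.Pairwise fun c c' => cellClass c ≤ cellClass c'

/-- The clusters `cl v`, for the centers `v ∈ C`, form an `r`-cluster cover for `V` in `H`. -/
structure IsClusterCover (H : SimpleGraph V) (r : ℝ) (C : Set V) (cl : V → Set V) : Prop where
  cluster : ∀ v ∈ C, ∀ w ∈ cl v, N.sp H v w ≤ ENNReal.ofReal r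
  disjoint : C.PairwiseDisjoint cl
  packing : ∀ v ∈ C, ∀ w ∈ C, v ≠ w → ENNReal.ofReal r < N.sp H v w
  covering : ∀ w, ∃ v ∈ C, w ∈ cl v

/-- `H` is an output of PLOS on the unit disk graph of the network `N`. -/
def IsPLOSOutput (k : ℕ) (ε β δ r : ℝ) (rule : ConeRule) (H : SimpleGraph V) : Prop :=
  ∃ YDelOf : ℤ × ℤ → SimpleGraph V,
    (∀ c, IsOrderedYao N (incidentGraph N k β δ c) rule (YDelOf c)) ∧
    ∃ cs, IsCellOrder N β δ cs ∧
      ∃ Y H₃, (Y, H₃) = cs.foldl (processCell N ε β δ) (⨆ c, YDelOf c, ⊥) ∧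
        ∃ C cl, IsClusterCover N Y r C cl ∧
          H = H₃ ⊔ SimpleGraph.fromRel fun v w => Y.Adj v w ∧ v ∈ C ∧ w ∈ C

end Algorithm

/-! ### Synchronous message passing -/

/-- A message: a list of identifiers of nodes with their coordinates. -/
abbrev Message := List NodeInfo

/-- A distributed algorithm for the synchronous message passing model. All nodes run the same
program; a node starts with its own identifier and coordinates only. In each round it sends finitely
many messages to each neighbor (`send s j` is for the neighbor with identifier `j`), receives the
messages sent to it, tagged with the identifier of the sender, and updates its state. In the end
it outputs a set of identifiers: the other endpoints of the incident edges that it selects. -/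
structure DistributedAlgorithm where
  State : Type
  init : NodeInfo → State
  send : State → ℕ → Finset Message
  receive : State → Set (ℕ × Message) → State
  output : State → Finset ℕ

namespace DistributedAlgorithm

variable {V : Type u} (A : DistributedAlgorithm) (N : Network V)

/-- The state of each node after `t` rounds on the unit disk graph of the network. -/
def state : ℕ → V → A.State
  | 0, v => A.init (N.info v)
  | t + 1, v => A.receive (state t v)
      {x | ∃ w, N.udg.Adj w v ∧ x.1 = N.ident w ∧ x.2 ∈ A.send (state t w) (N.ident v)}

/-- In each of the first `R` rounds, each message sent consists of at most `b` identifiers, with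
coordinates, of nodes of the network. -/
def ShortMessages (R b : ℕ) : Prop :=
  ∀ t < R, ∀ v w, N.udg.Adj v w → ∀ m ∈ A.send (A.state N t v) (N.ident w),
    m.length ≤ b ∧ ∀ x ∈ m, ∃ y, x = N.info y

/-- After `R` rounds each node outputs exactly its neighbors in `H`. -/
def Outputs (R : ℕ) (H : SimpleGraph V) : Prop :=
  ∀ (v : V) (j : ℕ), j ∈ A.output (A.state N R v) ↔ ∃ w, H.Adj v w ∧ N.ident w = j

end DistributedAlgorithm

end

end PLOS

/-!
The theorem is true because PLOS has an output that is *local*: there is a constant `R` such that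
the edges of this output at a node are determined by the nodes within `R` hops of it. Given such
an output, the algorithm is flooding: in `R` rounds each node learns the nodes within `R` hops,
one node per message, then it computes the output on the network that they form and reads off its
own edges (`outputs_localOutput`).

Locality is expressed for a map `f` that identifies a network `N'` with a subnetwork of `N`: if
the subnetwork contains all nodes of `N` within `t` hops of `f a`, then the graphs computed on
`N'` and on `N` agree at `a` (`LocalAgree`). The parts of PLOS are local for the following
reasons.

* Edges of `LDel` have length at most one and depend on nodes within `k + 1` hops (`ldel_adj`).
* All edges incident to a cell are within a few hops of any node in it. The ordered Yao method
  removes the nodes in an order that is unique, and nodes isolated in the graph do not affect the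
  order of the others (`IsYaoOrder.lt_iff_lt`). So the ordered Yao graph of such a cell on `N` is
  the image of the one on `N'` (`yaoGraph_adj_iff`, `yDel_adj`).
* The edges of `YDel` join nodes at most two hops apart. A path in such a graph may have many
  edges, but if its Euclidean length is at most `X`, then it stays within `3 * X + 1` hops of its
  start (`near_of_mem_support`). Hence bounded distances in the graph are local (`sp_le_iff`), and
  so is the greedy filter on a single cell (`keptGraph_adj_iff`).
* The cells may be processed in any order within a class. They are ordered by a coloring with
  finitely many colors that refines the classes, in which distinct cells of the same color are so
  far apart that they do not influence each other (`lt_dist_of_cellColor_eq`,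
  `foldl_processCell_adj`). So each color adds a constant to the radius needed
  (`localAgree_filterState`).
* The centers of the clusters are chosen greedily, by the color of a cell that contains the node
  and then by identifier. The nodes in a cell being a clique, again each color adds a constant to
  the radius (`isCenter_iff_of_localAgree`).
-/

namespace PLOS

open scoped ENNReal

noncomputable section

universe u w

/-! ### Hop distances -/

namespace Network

variable {V : Type u} {W : Type w} (N : Network V)

theorem len_comm (a b : V) : N.len a b = N.len b a := dist_comm _ _

theorem len_nonneg (a b : V) : 0 ≤ N.len a b := dist_nonneg

theorem len_self (a : V) : N.len a a = 0 := dist_self _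

theorem len_triangle (a b c : V) : N.len a c ≤ N.len a b + N.len b c := dist_triangle _ _ _

/-- `b` is within `n` hops of `a` in the unit disk graph. -/
def Near (n : ℕ) (a b : V) : Prop := N.udg.edist a b ≤ n

variable {N}

theorem Near.refl (n : ℕ) (a : V) : N.Near n a a := by simp [Near]

theorem Near.symm {n : ℕ} {a b : V} (h : N.Near n a b) : N.Near n b a := by
  unfold Near at *; rwa [SimpleGraph.edist_comm]

theorem Near.mono {m n : ℕ} {a b : V} (h : N.Near m a b) (hmn : m ≤ n) : N.Near n a b :=
  le_trans h (by exact_mod_cast hmn)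

theorem Near.trans {m n : ℕ} {a b c : V} (h : N.Near m a b) (h' : N.Near n b c) :
    N.Near (m + n) a c := by
  unfold Near at *
  push_cast
  exact SimpleGraph.edist_triangle.trans (add_le_add h h')

theorem near_iff_exists_walk {n : ℕ} {a b : V} :
    N.Near n a b ↔ ∃ p : N.udg.Walk a b, p.length ≤ n := by
  constructor
  · intro h
    have ht : N.udg.edist a b ≠ ⊤ := ne_top_of_le_ne_top (ENat.natCast_ne_top n) h
    obtain ⟨p, hp⟩ := SimpleGraph.exists_walk_of_edist_ne_top ht
    refine ⟨p, ?_⟩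
    unfold Near at h
    rw [← hp] at h
    exact_mod_cast h
  · rintro ⟨p, hp⟩
    exact (SimpleGraph.edist_le p).trans (by exact_mod_cast hp)

theorem near_one_of_len_le {a b : V} (h : N.len a b ≤ 1) : N.Near 1 a b := by
  by_cases hab : a = b
  · exact hab ▸ Near.refl _ _
  · exact near_iff_exists_walk.2
      ⟨SimpleGraph.Walk.cons (show N.udg.Adj a b from ⟨hab, h⟩) .nil, by simp⟩

theorem near_one_of_adj {a b : V} (h : N.udg.Adj a b) : N.Near 1 a b := near_one_of_len_le h.2

theorem near_zero_iff {a b : V} : N.Near 0 a b ↔ a = b := by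
  simp [Near]

theorem near_succ_iff {n : ℕ} {a b : V} :
    N.Near (n + 1) a b ↔ N.Near n a b ∨ ∃ c, N.udg.Adj c b ∧ N.Near n a c := by
  constructor
  · intro h
    obtain ⟨p, hp⟩ := near_iff_exists_walk.1 h.symm
    cases p with
    | nil => exact .inl (Near.refl _ _)
    | cons hbc q =>
      refine .inr ⟨_, hbc.symm, Near.symm (near_iff_exists_walk.2 ⟨q, ?_⟩)⟩
      simpa using hp
  · rintro (h | ⟨c, hc, h⟩)
    · exact h.mono (Nat.le_succ n)
    · exact h.trans (near_one_of_adj hc)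

theorem Near.len_le {n : ℕ} {a b : V} (h : N.Near n a b) : N.len a b ≤ n := by
  induction n generalizing b with
  | zero => rw [near_zero_iff.1 h, len_self]; simp
  | succ n ih =>
    push_cast
    rcases near_succ_iff.1 h with h | ⟨c, hc, h⟩
    · linarith [ih h]
    · linarith [ih h, hc.2, N.len_triangle a c b]

/-! ### Lengths of walks -/

theorem walkLength_nonneg {Q : SimpleGraph V} {a b : V} (p : Q.Walk a b) :
    0 ≤ N.walkLength p := by
  apply List.sum_nonneg
  intro x hx
  obtain ⟨d, -, rfl⟩ := List.mem_map.1 hx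
  exact N.len_nonneg _ _

theorem walkLength_cons {Q : SimpleGraph V} {a b c : V} (h : Q.Adj a b) (p : Q.Walk b c) :
    N.walkLength (.cons h p) = N.len a b + N.walkLength p := by
  simp [walkLength]

theorem walkLength_append {Q : SimpleGraph V} {a b c : V} (p : Q.Walk a b) (q : Q.Walk b c) :
    N.walkLength (p.append q) = N.walkLength p + N.walkLength q := by
  simp [walkLength]

theorem walkLength_reverse {Q : SimpleGraph V} {a b : V} (p : Q.Walk a b) :
    N.walkLength p.reverse = N.walkLength p := by
  simp only [walkLength, SimpleGraph.Walk.darts_reverse, List.map_reverse, List.sum_reverse,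
    List.map_map]
  congr 1
  apply List.map_congr_left
  intro d _
  exact N.len_comm _ _

theorem sp_self (Q : SimpleGraph V) (a : V) : N.sp Q a a = 0 := by
  refine le_antisymm ?_ (zero_le)
  refine (iInf_le _ (SimpleGraph.Walk.nil : Q.Walk a a)).trans ?_
  simp [walkLength]

theorem sp_comm (Q : SimpleGraph V) (a b : V) : N.sp Q a b = N.sp Q b a := by
  have key : ∀ a b : V, N.sp Q a b ≤ N.sp Q b a := fun a b =>
    le_iInf fun p => (iInf_le _ p.reverse).trans (by rw [walkLength_reverse])
  exact le_antisymm (key a b) (key b a)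

/-- The edges of `Q` join nodes at most two hops apart. Such graphs arise from the ordered Yao
method, which may join two neighbors of a node. -/
def TwoHop (N : Network V) (Q : SimpleGraph V) : Prop := ∀ a b, Q.Adj a b → N.Near 2 a b

theorem TwoHop.mono {Q Q' : SimpleGraph V} (h : N.TwoHop Q) (hle : Q' ≤ Q) : N.TwoHop Q' :=
  fun a b hab => h a b (hle hab)

/-- Follow the walk from its start `a`, and keep an anchor `x` within distance one of the
current node. The anchor needs to move, by at most three hops, only when the length traversed since
it was chosen exceeds one. -/
theorem exists_near_of_walk {Q : SimpleGraph V} (hQ : N.TwoHop Q) {a b : V} (p : Q.Walk a b)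
    (x : V) (hx : N.len x a ≤ 1) :
    ∃ n : ℕ, N.Near n x b ∧ (n : ℝ) ≤ 3 * (N.len x a + N.walkLength p) + 1 := by
  induction p generalizing x with
  | @nil a =>
    refine ⟨1, near_one_of_len_le hx, ?_⟩
    have h0 : N.len x a ≥ 0 := N.len_nonneg x a
    simpa [walkLength] using h0
  | @cons a c b h q ih =>
    rw [walkLength_cons]
    by_cases hd : N.len x a + N.len a c ≤ 1
    · have ht := N.len_triangle x a c
      obtain ⟨n, hn, hn'⟩ := ih x (ht.trans hd)
      exact ⟨n, hn, by linarith⟩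
    · obtain ⟨n, hn, hn'⟩ := ih c (by rw [len_self]; norm_num)
      refine ⟨1 + 2 + n, ((near_one_of_len_le hx).trans (hQ _ _ h)).trans hn, ?_⟩
      rw [len_self] at hn'
      push_cast
      linarith

theorem near_of_walkLength_le {Q : SimpleGraph V} (hQ : N.TwoHop Q) {a b : V} (p : Q.Walk a b)
    {X : ℝ} (hX : N.walkLength p ≤ X) {D : ℕ} (hD : 3 * X + 1 ≤ D) : N.Near D a b := by
  obtain ⟨n, hn, hn'⟩ := exists_near_of_walk hQ p a (by rw [len_self]; norm_num)
  rw [len_self] at hn'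
  refine hn.mono ?_
  have : (n : ℝ) ≤ D := by linarith
  exact_mod_cast this

theorem near_of_mem_support {Q : SimpleGraph V} (hQ : N.TwoHop Q) {a b : V} (p : Q.Walk a b)
    {X : ℝ} (hX : N.walkLength p ≤ X) {D : ℕ} (hD : 3 * X + 1 ≤ D) {x : V} (hx : x ∈ p.support) :
    N.Near D a x := by
  classical
  refine near_of_walkLength_le hQ (p.takeUntil x hx) (le_trans ?_ hX) hD
  conv_rhs => rw [← p.take_spec hx, walkLength_append]
  linarith [N.walkLength_nonneg (p.dropUntil x hx)]

theorem near_of_sp_le {Q : SimpleGraph V} (hQ : N.TwoHop Q) {a b : V} {x X : ℝ} (hx : 0 ≤ x)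
    (hxX : x < X) (h : N.sp Q a b ≤ ENNReal.ofReal x) {D : ℕ} (hD : 3 * X + 1 ≤ D) :
    N.Near D a b := by
  have hlt : N.sp Q a b < ENNReal.ofReal X :=
    h.trans_lt ((ENNReal.ofReal_lt_ofReal_iff (hx.trans_lt hxX)).2 hxX)
  obtain ⟨p, hp⟩ := iInf_lt_iff.1 hlt
  exact near_of_walkLength_le hQ p ((ENNReal.ofReal_lt_ofReal_iff (hx.trans_lt hxX)).1 hp).le hD

/-! ### Subnetworks -/

/-- `f` identifies `N'` with the subnetwork of `N` formed by the nodes in the range of `f`. -/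
def IsSubnetwork (N' : Network W) (N : Network V) (f : W → V) : Prop :=
  ∀ a, N.info (f a) = N'.info a

/-- The subnetwork contains all nodes within `t` hops of `a` in the whole network. -/
def Covers (N : Network V) (f : W → V) (a : W) (t : ℕ) : Prop :=
  ∀ x, N.Near t (f a) x → x ∈ Set.range f

theorem Covers.mono {f : W → V} {a : W} {s t : ℕ} (h : N.Covers f a t) (hst : s ≤ t) :
    N.Covers f a s := fun x hx => h x (hx.mono hst)

theorem covers_id (a : V) (t : ℕ) : N.Covers id a t := by simp [Covers]

theorem isSubnetwork_id (N : Network V) : IsSubnetwork N N id := fun _ => rfl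

namespace IsSubnetwork

variable {N' : Network W} {f : W → V} (hf : IsSubnetwork N' N f)
include hf

theorem ident_eq (a : W) : N.ident (f a) = N'.ident a := congrArg NodeInfo.ident (hf a)

theorem pos_eq (a : W) : N.pos (f a) = N'.pos a := congrArg NodeInfo.pos (hf a)

theorem injective : Function.Injective f := fun a b hab =>
  N'.ident_injective (by rw [← hf.ident_eq, ← hf.ident_eq, hab])

theorem len_eq (a b : W) : N.len (f a) (f b) = N'.len a b := by
  simp only [len, hf.pos_eq]

theorem udg_adj (a b : W) : N.udg.Adj (f a) (f b) ↔ N'.udg.Adj a b := by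
  change f a ≠ f b ∧ _ ≤ _ ↔ a ≠ b ∧ _ ≤ _
  rw [hf.len_eq, hf.injective.ne_iff]

theorem near_map {n : ℕ} {a b : W} (h : N'.Near n a b) : N.Near n (f a) (f b) := by
  induction n generalizing b with
  | zero => rw [near_zero_iff] at *; rw [h]
  | succ n ih =>
    rw [near_succ_iff] at *
    rcases h with h | ⟨c, hc, h⟩
    · exact .inl (ih h)
    · exact .inr ⟨f c, (hf.udg_adj c b).2 hc, ih h⟩

theorem exists_near {n : ℕ} {a : W} {x : V} (hc : N.Covers f a n) (h : N.Near n (f a) x) :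
    ∃ b, f b = x ∧ N'.Near n a b := by
  induction n generalizing x with
  | zero =>
    rw [near_zero_iff] at h
    exact ⟨a, h, Near.refl _ _⟩
  | succ n ih =>
    obtain ⟨b, rfl⟩ := hc x h
    refine ⟨b, rfl, ?_⟩
    rw [near_succ_iff] at h
    rcases h with h | ⟨c, hcb, h⟩
    · obtain ⟨b', hb', h'⟩ := ih (hc.mono (Nat.le_succ n)) h
      rw [hf.injective hb'] at h'
      exact h'.mono (Nat.le_succ n)
    · obtain ⟨c, rfl, h'⟩ := ih (hc.mono (Nat.le_succ n)) h
      exact near_succ_iff.2 (.inr ⟨c, (hf.udg_adj c b).1 hcb, h'⟩)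

theorem near_iff {n : ℕ} {a b : W} (hc : N.Covers f a n) :
    N.Near n (f a) (f b) ↔ N'.Near n a b := by
  refine ⟨fun h => ?_, hf.near_map⟩
  obtain ⟨b', hb', h'⟩ := hf.exists_near hc h
  rwa [hf.injective hb'] at h'

theorem covers_of_near {s t : ℕ} {a b : W} (hc : N.Covers f a (s + t)) (h : N'.Near s a b) :
    N.Covers f b t := fun x hx => hc x ((hf.near_map h).trans hx)

/-! ### Locality of bounded shortest paths -/

/-- The graphs `Q'` and `Q` agree on all edges with an endpoint within `D` hops of `a`. -/
def _root_.PLOS.Network.AgreeNear (N' : Network W) (f : W → V) (Q' : SimpleGraph W)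
    (Q : SimpleGraph V) (a : W) (D : ℕ) : Prop :=
  ∀ x y, N'.Near D a x → (Q'.Adj x y ↔ Q.Adj (f x) (f y))

theorem exists_walk_map {Q' : SimpleGraph W} {Q : SimpleGraph V} {a b : W} (p : Q'.Walk a b)
    (h : ∀ x ∈ p.support, ∀ y, Q'.Adj x y → Q.Adj (f x) (f y)) :
    ∃ q : Q.Walk (f a) (f b), N.walkLength q = N'.walkLength p := by
  induction p with
  | nil => exact ⟨.nil, by simp [walkLength]⟩
  | cons hac p ih =>
    obtain ⟨q, hq⟩ := ih fun x hx => h x (by simp [hx])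
    exact ⟨.cons (h _ (by simp) _ hac) q, by rw [walkLength_cons, walkLength_cons, hq, hf.len_eq]⟩

theorem exists_walk_comap {Q' : SimpleGraph W} {Q : SimpleGraph V} {x y : V} (p : Q.Walk x y)
    (hr : ∀ z ∈ p.support, z ∈ Set.range f)
    (h : ∀ a b, f a ∈ p.support → Q.Adj (f a) (f b) → Q'.Adj a b) {a b : W}
    (ha : f a = x) (hb : f b = y) :
    ∃ q : Q'.Walk a b, N'.walkLength q = N.walkLength p := by
  induction p generalizing a with
  | nil =>
    obtain rfl := hf.injective (ha.trans hb.symm)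
    exact ⟨.nil, by simp [walkLength]⟩
  | @cons x z y hxz p ih =>
    obtain ⟨c, rfl⟩ := hr z (by simp)
    subst ha
    obtain ⟨q, hq⟩ := ih (fun x hx => hr x (by simp [hx]))
      (fun a b ha => h a b (by simp [ha])) rfl hb
    exact ⟨.cons (h _ _ (by simp) hxz) q, by rw [walkLength_cons, walkLength_cons, hq, hf.len_eq]⟩

omit hf in
theorem sp_le_of_walks {Q' : SimpleGraph W} {Q : SimpleGraph V} {a b : W} {a' b' : V} {x X : ℝ}
    (hx : 0 ≤ x) (hxX : x < X)
    (h : ∀ p : Q'.Walk a b, N'.walkLength p ≤ X → ∃ q : Q.Walk a' b',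
      N.walkLength q = N'.walkLength p)
    (hsp : N'.sp Q' a b ≤ ENNReal.ofReal x) : N.sp Q a' b' ≤ ENNReal.ofReal x := by
  have hX : 0 < X := hx.trans_lt hxX
  refine le_of_forall_gt fun y hy => ?_
  have hlt : N'.sp Q' a b < min y (ENNReal.ofReal X) :=
    hsp.trans_lt (lt_min hy ((ENNReal.ofReal_lt_ofReal_iff hX).2 hxX))
  obtain ⟨p, hp⟩ := iInf_lt_iff.1 hlt
  obtain ⟨q, hq⟩ := h p ((ENNReal.ofReal_lt_ofReal_iff hX).1 (hp.trans_le (min_le_right _ _))).le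
  exact (iInf_le _ q).trans_lt (by rw [hq]; exact hp.trans_le (min_le_left _ _))

/-- Whether the distance of two nodes in a graph is at most `x` can be decided from the part of
the graph within a bounded number of hops. -/
theorem sp_le_iff {Q' : SimpleGraph W} {Q : SimpleGraph V} (hQ' : N'.TwoHop Q')
    (hQ : N.TwoHop Q) {a b : W} {x X : ℝ} (hx : 0 ≤ x) (hxX : x < X) {D : ℕ}
    (hD : 3 * X + 1 ≤ D) (hc : N.Covers f a D) (hag : AgreeNear N' f Q' Q a D) :
    N'.sp Q' a b ≤ ENNReal.ofReal x ↔ N.sp Q (f a) (f b) ≤ ENNReal.ofReal x := by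
  constructor
  · refine sp_le_of_walks hx hxX fun p hp => hf.exists_walk_map p fun y hy z => ?_
    exact (hag y z (near_of_mem_support hQ' p hp hD hy)).1
  · refine sp_le_of_walks hx hxX fun p hp => hf.exists_walk_comap p ?_ ?_ rfl rfl
    · exact fun z hz => hc z (near_of_mem_support hQ p hp hD hz)
    · intro y z hy
      exact (hag y z ((hf.near_iff hc).1 (near_of_mem_support hQ p hp hD hy))).2

end IsSubnetwork

end Network

/-! ### Locality of the localized Delaunay graph -/

namespace Network

variable {V : Type u} {W : Type w} {N : Network V}

theorem ldel_adj_iff {k : ℕ} {a b : V} : (N.ldel k).Adj a b ↔ a ≠ b ∧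
    (N.IsGabrielEdge a b ∨ (∃ x, N.IsLocalizedDelaunayTriangle k a b x) ∨
      ∃ x, N.IsLocalizedDelaunayTriangle k b a x) := by
  have hsymm : N.IsGabrielEdge b a ↔ N.IsGabrielEdge a b := by
    unfold IsGabrielEdge
    rw [midpoint_comm, N.len_comm, N.udg.adj_comm]
  simp only [ldel, SimpleGraph.fromRel_adj, hsymm]
  tauto

theorem udg_adj_of_ldel {k : ℕ} {a b : V} (h : (N.ldel k).Adj a b) : N.udg.Adj a b := by
  rcases (ldel_adj_iff.1 h).2 with h | ⟨x, h⟩ | ⟨x, h⟩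
  · exact h.1
  · exact h.2.1
  · exact h.2.1.symm

/-- The graph `G` is the image of `G'` under `f`: there are no edges outside the subnetwork. -/
def IsImageGraph (f : W → V) (G' : SimpleGraph W) (G : SimpleGraph V) : Prop :=
  (∀ a b, G'.Adj a b ↔ G.Adj (f a) (f b)) ∧
    ∀ x y, G.Adj x y → x ∈ Set.range f ∧ y ∈ Set.range f

namespace IsSubnetwork

variable {N' : Network W} {f : W → V} (hf : IsSubnetwork N' N f)
include hf

theorem isGabrielEdge_iff {a b : W} (hc : N.Covers f a 1) :
    N'.IsGabrielEdge a b ↔ N.IsGabrielEdge (f a) (f b) := by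
  unfold IsGabrielEdge
  rw [hf.udg_adj, hf.pos_eq, hf.pos_eq, hf.len_eq]
  refine and_congr_right fun hab => ⟨fun h x hx => ?_, fun h x => hf.pos_eq x ▸ h (f x)⟩
  have hr : x ∈ Set.range f := by
    refine hc x (near_one_of_len_le ?_)
    have hm : dist (N'.pos a) (midpoint ℝ (N'.pos a) (N'.pos b)) = N'.len a b / 2 := by
      rw [dist_left_midpoint]; simp [len]; ring
    have h1 := hab.2
    have h2 := dist_triangle_right (N'.pos a) (N.pos x) (midpoint ℝ (N'.pos a) (N'.pos b))
    rw [Metric.mem_ball] at hx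
    unfold len at *
    rw [hf.pos_eq]
    linarith
  obtain ⟨x, rfl⟩ := hr
  exact h x (hf.pos_eq x ▸ hx)

theorem isLocalizedDelaunayTriangle_iff {k : ℕ} {a b c : W} (ha : N.Covers f a k)
    (hb : N.Covers f b k) (hc : N.Covers f c k) :
    N'.IsLocalizedDelaunayTriangle k a b c ↔
      N.IsLocalizedDelaunayTriangle k (f a) (f b) (f c) := by
  unfold IsLocalizedDelaunayTriangle
  simp only [hf.udg_adj, hf.pos_eq]
  refine and_congr_right fun _ => and_congr_right fun _ => and_congr_right fun _ =>
    and_congr_right fun _ => exists_congr fun o => exists_congr fun ρ => and_congr_right fun _ =>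
    and_congr_right fun _ => and_congr_right fun _ => ⟨fun h x hx => ?_, fun h x hx => ?_⟩
  · have : ∃ y, f y = x ∧ (N'.Near k a y ∨ N'.Near k b y ∨ N'.Near k c y) := by
      rcases hx with hx | hx | hx
      · obtain ⟨y, hy, h⟩ := hf.exists_near ha hx
        exact ⟨y, hy, .inl h⟩
      · obtain ⟨y, hy, h⟩ := hf.exists_near hb hx
        exact ⟨y, hy, .inr (.inl h)⟩
      · obtain ⟨y, hy, h⟩ := hf.exists_near hc hx
        exact ⟨y, hy, .inr (.inr h)⟩
    obtain ⟨y, rfl, hy⟩ := this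
    rw [hf.pos_eq]
    exact h y hy
  · rw [← hf.pos_eq]
    exact h (f x) (hx.imp hf.near_map (Or.imp hf.near_map hf.near_map))

theorem exists_isLocalizedDelaunayTriangle_iff {k : ℕ} {a b : W} (ha : N.Covers f a (k + 1))
    (hb : N.Covers f b k) :
    (∃ c, N'.IsLocalizedDelaunayTriangle k a b c) ↔
      ∃ c, N.IsLocalizedDelaunayTriangle k (f a) (f b) c := by
  have hk := ha.mono (Nat.le_succ k)
  rw [add_comm] at ha
  constructor
  · rintro ⟨c, h⟩
    have hc := hf.covers_of_near ha (near_one_of_adj h.2.2.2.1)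
    exact ⟨f c, (hf.isLocalizedDelaunayTriangle_iff hk hb hc).1 h⟩
  · rintro ⟨c, h⟩
    obtain ⟨c, rfl, hn⟩ := hf.exists_near (ha.mono (Nat.le_add_right 1 k))
      (near_one_of_adj h.2.2.2.1)
    exact ⟨c, (hf.isLocalizedDelaunayTriangle_iff hk hb (hf.covers_of_near ha hn)).2 h⟩

theorem ldel_adj {k : ℕ} {a b : W} (hc : N.Covers f a (k + 2)) :
    (N'.ldel k).Adj a b ↔ (N.ldel k).Adj (f a) (f b) := by
  have key : N'.udg.Adj a b → ((N'.ldel k).Adj a b ↔ (N.ldel k).Adj (f a) (f b)) := by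
    intro hab
    have hb : N.Covers f b (k + 1) :=
      hf.covers_of_near (hc.mono (by omega : 1 + (k + 1) ≤ k + 2)) (near_one_of_adj hab)
    rw [ldel_adj_iff, ldel_adj_iff, hf.injective.ne_iff,
      hf.isGabrielEdge_iff (hc.mono (by omega)),
      hf.exists_isLocalizedDelaunayTriangle_iff (hc.mono (by omega)) (hb.mono (by omega)),
      hf.exists_isLocalizedDelaunayTriangle_iff hb (hc.mono (by omega))]
  exact ⟨fun h => (key (udg_adj_of_ldel h)).1 h,
    fun h => (key ((hf.udg_adj a b).1 (udg_adj_of_ldel h))).2 h⟩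

end IsSubnetwork

end Network

/-! ### The order of the ordered Yao method -/

section YaoOrder

variable {V : Type u} {W : Type w} {N : Network V} {N' : Network W}

theorem exists_isYaoOrder [Finite V] (N : Network V) (G : SimpleGraph V) :
    ∃ π, IsYaoOrder N G π := by
  classical
  have := Fintype.ofFinite V
  -- Every set `s` of remaining nodes has an order; the node removed first is ranked last.
  have key : ∀ (n : ℕ) (s : Finset V), s.card = n → ∃ π : V → ℕ, Set.InjOn π s ∧
      (∀ v ∈ s, π v ∈ Set.Icc 1 n) ∧ ∀ v ∈ s, ∀ w ∈ s, π w ≤ π v →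
        toLex ({x | x ∈ s ∧ π x ≤ π v ∧ G.Adj v x}.ncard, N.ident v) ≤
          toLex ({x | x ∈ s ∧ π x ≤ π v ∧ G.Adj w x}.ncard, N.ident w) := by
    intro n
    induction n with
    | zero =>
      intro s hs
      obtain rfl := Finset.card_eq_zero.1 hs
      exact ⟨fun _ => 0, by simp, by simp, by simp⟩
    | succ n ih =>
      intro s hs
      have hne : s.Nonempty := Finset.card_pos.1 (by omega)
      obtain ⟨m, hm, hmin⟩ := s.exists_min_image
        (fun v => toLex ({x | x ∈ s ∧ G.Adj v x}.ncard, N.ident v)) hne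
      obtain ⟨π, hinj, hmem, hπ⟩ := ih (s.erase m) (by rw [Finset.card_erase_of_mem hm]; omega)
      have hlt : ∀ v ∈ s, v ≠ m → Function.update π m (n + 1) v = π v ∧ π v ∈ Set.Icc 1 n :=
        fun v hv hvm => ⟨Function.update_of_ne hvm _ _, hmem v (Finset.mem_erase.2 ⟨hvm, hv⟩)⟩
      have hself : Function.update π m (n + 1) m = n + 1 := Function.update_self _ _ _
      have hle : ∀ v ∈ s, Function.update π m (n + 1) v ≤ n + 1 := fun v hv => by
        by_cases h : v = m
        · rw [h, hself]
        · rw [(hlt v hv h).1]; exact (hlt v hv h).2.2.trans (Nat.le_succ n)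
      refine ⟨Function.update π m (n + 1), ?_, ?_, ?_⟩
      · intro v hv w hw h
        by_cases hvm : v = m <;> by_cases hwm : w = m
        · rw [hvm, hwm]
        · have := hlt w hw hwm
          rw [hvm, hself, this.1] at h
          have := this.2.2
          omega
        · have := hlt v hv hvm
          rw [hwm, hself, this.1] at h
          have := this.2.2
          omega
        · rw [(hlt v hv hvm).1, (hlt w hw hwm).1] at h
          exact hinj (by simp [hvm, Finset.mem_coe.1 hv]) (by simp [hwm, Finset.mem_coe.1 hw]) h
      · intro v hv
        by_cases hvm : v = m
        · rw [hvm, hself]; exact ⟨by omega, le_rfl⟩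
        · rw [(hlt v hv hvm).1]
          exact ⟨(hlt v hv hvm).2.1, (hlt v hv hvm).2.2.trans (Nat.le_succ n)⟩
      · intro v hv w hw hwv
        by_cases hvm : v = m
        · have hset : ∀ y, {x | x ∈ s ∧ Function.update π m (n + 1) x ≤
              Function.update π m (n + 1) v ∧ G.Adj y x} = {x | x ∈ s ∧ G.Adj y x} := by
            intro y
            ext x
            simp only [Set.mem_ofPred_eq, and_congr_right_iff, and_iff_right_iff_imp]
            intro hx _
            rw [hvm, hself]
            exact hle x hx
          rw [hset, hset, hvm]
          exact hmin w hw
        · have hv' := hlt v hv hvm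
          have hwm : w ≠ m := by
            rintro rfl
            rw [hself, hv'.1] at hwv
            have := hv'.2.2
            omega
          have hset : ∀ y, {x | x ∈ s ∧ Function.update π m (n + 1) x ≤
              Function.update π m (n + 1) v ∧ G.Adj y x} =
              {x | x ∈ s.erase m ∧ π x ≤ π v ∧ G.Adj y x} := by
            intro y
            ext x
            simp only [Set.mem_ofPred_eq, Finset.mem_erase]
            rw [hv'.1]
            by_cases hxm : x = m
            · subst hxm
              rw [hself]
              have := hv'.2.2
              constructor
              · rintro ⟨-, h, -⟩
                omega
              · rintro ⟨⟨h, -⟩, -⟩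
                exact absurd rfl h
            · rw [Function.update_of_ne hxm]
              tauto
          rw [hset, hset]
          refine hπ v (Finset.mem_erase.2 ⟨hvm, hv⟩) w (Finset.mem_erase.2 ⟨hwm, hw⟩) ?_
          rwa [hv'.1, (hlt w hw hwm).1] at hwv
  obtain ⟨π, hinj, hmem, hπ⟩ := key _ Finset.univ rfl
  refine ⟨π, fun v w h => hinj (by simp) (by simp) h, fun v => ?_, fun v w h => ?_⟩
  · rw [Nat.card_eq_fintype_card]
    exact hmem v (by simp)
  · simpa using hπ v (by simp) w (by simp) h

/-- `π` removes the nodes in the order of the ordered Yao method; in contrast to `IsYaoOrder`, its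
values may have gaps. -/
def IsRemovalOrder (N : Network V) (G : SimpleGraph V) (π : V → ℕ) : Prop :=
  Function.Injective π ∧ ∀ v w, π w ≤ π v →
    toLex ({x | π x ≤ π v ∧ G.Adj v x}.ncard, N.ident v) ≤
      toLex ({x | π x ≤ π v ∧ G.Adj w x}.ncard, N.ident w)

/-- As long as the same nodes have been removed, the same node is removed next. -/
theorem IsRemovalOrder.setOf_lt_eq [Finite V] {G : SimpleGraph V} {π₁ π₂ : V → ℕ}
    (h₁ : IsRemovalOrder N G π₁) (h₂ : IsRemovalOrder N G π₂) (v : V) :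
    {x | π₁ v < π₁ x} = {x | π₂ v < π₂ x} := by
  by_contra hv
  -- Take the first node removed by `π₁` for which the claim fails.
  obtain ⟨v, hv, hmax⟩ := (Set.toFinite {v | {x | π₁ v < π₁ x} ≠
    {x | π₂ v < π₂ x}}).exists_maximalFor π₁ _ ⟨v, hv⟩
  have hup : ∀ x, π₁ v < π₁ x → {y | π₁ x < π₁ y} = {y | π₂ x < π₂ y} := by
    intro x hx
    by_contra h
    exact absurd (hmax h hx.le) (not_le.2 hx)
  -- The node that `π₂` removes first among those that remain just before `π₁` removes `v`.
  obtain ⟨y, hy, hymax⟩ := (Set.toFinite {y | π₁ y ≤ π₁ v}).exists_maximalFor π₂ _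
    ⟨v, le_refl (π₁ v)⟩
  have hymax' : ∀ x, π₁ x ≤ π₁ v → π₂ x ≤ π₂ y := fun x hx => by
    by_contra h
    exact h (hymax hx (not_le.1 h).le)
  have hrem : {x | π₂ x ≤ π₂ y} = {x | π₁ x ≤ π₁ v} := by
    ext x
    refine ⟨fun hx => ?_, hymax' x⟩
    by_contra hxv
    have hxv' : π₁ v < π₁ x := not_le.1 hxv
    have hne : x ≠ y := by
      rintro rfl
      exact hxv hy
    have hlt : π₂ x < π₂ y := lt_of_le_of_ne hx (h₂.1.ne hne)
    have hmem : y ∈ {z | π₁ x < π₁ z} := by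
      rw [hup x hxv']
      exact hlt
    exact absurd (hxv'.trans hmem) (not_lt.2 hy)
  have hrem' : ∀ x, π₂ x ≤ π₂ y ↔ π₁ x ≤ π₁ v := fun x => Set.ext_iff.1 hrem x
  have hle₁ := h₁.2 v y hy
  have hle₂ := h₂.2 y v ((hrem' v).2 le_rfl)
  simp only [hrem'] at hle₂
  have hident : N.ident v = N.ident y :=
    congrArg (fun p => (ofLex p).2) (le_antisymm hle₁ hle₂)
  obtain rfl := N.ident_injective hident
  refine hv (Set.ext fun x => ?_)
  have := hrem' x
  simp only [Set.mem_ofPred_eq]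
  omega

theorem IsRemovalOrder.lt_iff_lt [Finite V] {G : SimpleGraph V} {π₁ π₂ : V → ℕ}
    (h₁ : IsRemovalOrder N G π₁) (h₂ : IsRemovalOrder N G π₂) (v w : V) :
    π₁ v < π₁ w ↔ π₂ v < π₂ w :=
  Set.ext_iff.1 (h₁.setOf_lt_eq h₂ v) w

open Network

/-- Nodes outside the subnetwork, being isolated in `G`, do not affect the degrees of the others,
and so they do not affect the order of the others. -/
theorem IsYaoOrder.lt_iff_lt [Finite W] {f : W → V} (hf : IsSubnetwork N' N f)
    {G' : SimpleGraph W} {G : SimpleGraph V} (hG : IsImageGraph f G' G) {π' : W → ℕ} {π : V → ℕ}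
    (h' : IsYaoOrder N' G' π') (h : IsYaoOrder N G π) (a b : W) :
    π (f a) < π (f b) ↔ π' a < π' b := by
  have hcard : ∀ a v, {x | π (f x) ≤ π (f v) ∧ G'.Adj a x}.ncard =
      {x | π x ≤ π (f v) ∧ G.Adj (f a) x}.ncard := by
    intro a v
    rw [← Set.ncard_image_of_injective _ hf.injective]
    congr 1
    ext x
    constructor
    · rintro ⟨x, ⟨h, hx⟩, rfl⟩
      exact ⟨h, (hG.1 _ _).1 hx⟩
    · rintro ⟨h, hx⟩
      obtain ⟨x, rfl⟩ := (hG.2 _ _ hx).2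
      exact ⟨x, ⟨h, (hG.1 _ _).2 hx⟩, rfl⟩
  refine IsRemovalOrder.lt_iff_lt (N := N') (G := G') (π₁ := π ∘ f) ⟨h.1.comp hf.injective, ?_⟩
    ⟨h'.1, h'.2.2⟩ a b
  intro v w hvw
  have := h.2.2 (f v) (f w) hvw
  rw [← hcard, ← hcard, hf.ident_eq, hf.ident_eq] at this
  exact this

end YaoOrder

/-! ### Invariance of the ordered Yao graph -/

section YaoGraph

open Network

variable {V : Type u} {W : Type w} {N : Network V} {N' : Network W} {f : W → V}

/-- The edge `ab`, in this orientation, is selected in the given cone at `v`. -/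
def YaoSelects (N : Network V) (G : SimpleGraph V) (rule : ConeRule) (π : V → ℕ) (v : V)
    (θ lo hi : ℝ) (a b : V) : Prop :=
  IsYaoCone N G rule π v θ lo hi ∧
    ((a = v ∧ b ∈ coneNbrs N G v θ lo hi ∧
        ∀ x ∈ coneNbrs N G v θ lo hi, N.edgeId s(v, b) ≤ N.edgeId s(v, x)) ∨
      (a ∈ coneNbrs N G v θ lo hi ∧ b ∈ coneNbrs N G v θ lo hi ∧
        ccw θ (N.pos a - N.pos v) < ccw θ (N.pos b - N.pos v) ∧
        ∀ x ∈ coneNbrs N G v θ lo hi,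
          ¬ (ccw θ (N.pos a - N.pos v) < ccw θ (N.pos x - N.pos v) ∧
             ccw θ (N.pos x - N.pos v) < ccw θ (N.pos b - N.pos v))))

theorem yaoGraph_adj {G : SimpleGraph V} {rule : ConeRule} {π : V → ℕ} {a b : V} :
    (yaoGraph N G rule π).Adj a b ↔ a ≠ b ∧ ((∃ v θ lo hi, YaoSelects N G rule π v θ lo hi a b) ∨
      ∃ v θ lo hi, YaoSelects N G rule π v θ lo hi b a) :=
  SimpleGraph.fromRel_adj _ _ _

namespace Network.IsSubnetwork

variable (hf : IsSubnetwork N' N f)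
include hf

theorem pos_image (s : Set W) : N.pos '' (f '' s) = N'.pos '' s := by
  rw [Set.image_image]
  exact Set.image_congr fun a _ => hf.pos_eq a

theorem dirEdgeId_eq (a b : W) : N.dirEdgeId (f a) (f b) = N'.dirEdgeId a b := by
  simp only [dirEdgeId, hf.len_eq, hf.ident_eq]

theorem edgeId_mk_eq (a b : W) : N.edgeId s(f a, f b) = N'.edgeId s(a, b) := by
  simp only [edgeId, Sym2.lift_mk, hf.dirEdgeId_eq]

theorem coneNbrs_eq {G' : SimpleGraph W} {G : SimpleGraph V} (hG : IsImageGraph f G' G) (a : W)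
    (θ lo hi : ℝ) : coneNbrs N G (f a) θ lo hi = f '' coneNbrs N' G' a θ lo hi := by
  ext x
  constructor
  · rintro ⟨h, h'⟩
    obtain ⟨x, rfl⟩ := (hG.2 _ _ h).2
    exact ⟨x, ⟨(hG.1 _ _).2 h, by simpa only [hf.pos_eq] using h'⟩, rfl⟩
  · rintro ⟨x, ⟨h, h'⟩, rfl⟩
    exact ⟨(hG.1 _ _).1 h, by simpa only [hf.pos_eq] using h'⟩

variable {G' : SimpleGraph W} {G : SimpleGraph V} (hG : IsImageGraph f G' G)
  {π' : W → ℕ} {π : V → ℕ} (hπ : ∀ a b, π (f a) < π (f b) ↔ π' a < π' b)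
include hG hπ

omit hf in
theorem processedNbrs_eq (a : W) : processedNbrs G π (f a) = f '' processedNbrs G' π' a := by
  ext x
  constructor
  · rintro ⟨h, h'⟩
    obtain ⟨x, rfl⟩ := (hG.2 _ _ h).2
    exact ⟨x, ⟨(hG.1 _ _).2 h, (hπ _ _).1 h'⟩, rfl⟩
  · rintro ⟨x, ⟨h, h'⟩, rfl⟩
    exact ⟨(hG.1 _ _).1 h, (hπ _ _).2 h'⟩

omit hf in
theorem unprocessedNbrs_eq (a : W) :
    unprocessedNbrs G π (f a) = f '' unprocessedNbrs G' π' a := by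
  ext x
  constructor
  · rintro ⟨h, h'⟩
    obtain ⟨x, rfl⟩ := (hG.2 _ _ h).2
    exact ⟨x, ⟨(hG.1 _ _).2 h, (hπ _ _).1 h'⟩, rfl⟩
  · rintro ⟨x, ⟨h, h'⟩, rfl⟩
    exact ⟨(hG.1 _ _).1 h, (hπ _ _).2 h'⟩

theorem isSector_iff (rule : ConeRule) (a : W) (θ A : ℝ) :
    IsSector N G rule π (f a) θ A ↔ IsSector N' G' rule π' a θ A := by
  unfold IsSector
  rw [processedNbrs_eq hG hπ, unprocessedNbrs_eq hG hπ, hf.pos_image, hf.pos_eq]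
  simp only [Set.image_eq_empty, Set.image_image, hf.pos_eq, Set.exists_mem_image]

theorem isYaoCone_iff (rule : ConeRule) (a : W) (θ lo hi : ℝ) :
    IsYaoCone N G rule π (f a) θ lo hi ↔ IsYaoCone N' G' rule π' a θ lo hi := by
  unfold IsYaoCone
  simp only [hf.isSector_iff hG hπ, processedNbrs_eq hG hπ, unprocessedNbrs_eq hG hπ,
    hf.pos_image, hf.pos_eq]

theorem yaoSelects_iff (rule : ConeRule) (v : W) (θ lo hi : ℝ) (a b : W) :
    YaoSelects N G rule π (f v) θ lo hi (f a) (f b) ↔ YaoSelects N' G' rule π' v θ lo hi a b := by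
  simp only [YaoSelects, hf.isYaoCone_iff hG hπ, hf.coneNbrs_eq hG, hf.injective.mem_set_image,
    hf.injective.eq_iff, hf.pos_eq, hf.edgeId_mk_eq, Set.forall_mem_image]

/-- The ordered Yao graph depends only on the edges of `G`, on the positions and identifiers of
their endpoints, and on the relative order of these endpoints. -/
theorem yaoGraph_adj_iff (rule : ConeRule) (a b : W) :
    (yaoGraph N G rule π).Adj (f a) (f b) ↔ (yaoGraph N' G' rule π').Adj a b := by
  have key : ∀ a b : W, (∃ v θ lo hi, YaoSelects N G rule π v θ lo hi (f a) (f b)) ↔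
      ∃ v θ lo hi, YaoSelects N' G' rule π' v θ lo hi a b := by
    intro a b
    constructor
    · rintro ⟨v, θ, lo, hi, h⟩
      have hr : v ∈ Set.range f := by
        rcases h.2 with ⟨rfl, -⟩ | ⟨ha, -⟩
        · exact ⟨a, rfl⟩
        · exact (hG.2 _ _ ha.1).1
      obtain ⟨v, rfl⟩ := hr
      exact ⟨v, θ, lo, hi, (hf.yaoSelects_iff hG hπ rule v θ lo hi a b).1 h⟩
    · rintro ⟨v, θ, lo, hi, h⟩
      exact ⟨f v, θ, lo, hi, (hf.yaoSelects_iff hG hπ rule v θ lo hi a b).2 h⟩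
  rw [yaoGraph_adj, yaoGraph_adj, key a b, key b a, hf.injective.ne_iff]

end Network.IsSubnetwork

/-- An edge of the ordered Yao graph joins a node to a neighbor, or two neighbors of a node. -/
theorem exists_adj_of_yaoGraph_adj {G : SimpleGraph V} {rule : ConeRule} {π : V → ℕ} {a b : V}
    (h : (yaoGraph N G rule π).Adj a b) :
    ∃ v, (v = a ∨ G.Adj v a) ∧ (v = b ∨ G.Adj v b) ∧ ∃ y, G.Adj a y := by
  have key : ∀ a b : V, (∃ v θ lo hi, YaoSelects N G rule π v θ lo hi a b) →
      ∃ v, (v = a ∨ G.Adj v a) ∧ (v = b ∨ G.Adj v b) ∧ (∃ y, G.Adj a y) ∧ ∃ y, G.Adj b y := by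
    rintro a b ⟨v, θ, lo, hi, -, ⟨rfl, hb, -⟩ | ⟨ha, hb, -⟩⟩
    · exact ⟨a, .inl rfl, .inr hb.1, ⟨b, hb.1⟩, ⟨a, hb.1.symm⟩⟩
    · exact ⟨v, .inr ha.1, .inr hb.1, ⟨v, ha.1.symm⟩, ⟨v, hb.1.symm⟩⟩
  rcases (yaoGraph_adj.1 h).2 with h | h
  · obtain ⟨v, h1, h2, h3, -⟩ := key a b h
    exact ⟨v, h1, h2, h3⟩
  · obtain ⟨v, h1, h2, -, h3⟩ := key b a h
    exact ⟨v, h2, h1, h3⟩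

end YaoGraph

/-! ### Locality of the union of the ordered Yao graphs -/

section YDel

open Network

variable {V : Type u} {W : Type w} {N : Network V} {N' : Network W} {f : W → V}

theorem Network.near_one_of_mem_cell {β δ : ℝ} (hβ : 0 < β) (hβ' : β ≤ 1 / √2) {c : ℤ × ℤ}
    {a b : V} (ha : N.pos a ∈ cell β δ c) (hb : N.pos b ∈ cell β δ c) : N.Near 1 a b := by
  apply near_one_of_len_le
  have h2 : β ^ 2 ≤ 1 / 2 := by
    have := pow_le_pow_left₀ hβ.le hβ' 2
    rwa [div_pow, Real.sq_sqrt (by norm_num), one_pow] at this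
  obtain ⟨a1, a2, a3, a4⟩ := ha
  obtain ⟨b1, b2, b3, b4⟩ := hb
  rw [len, Complex.dist_eq_re_im, Real.sqrt_le_iff]
  have hx : ((N.pos a).re - (N.pos b).re) ^ 2 ≤ β ^ 2 := sq_le_sq' (by linarith) (by linarith)
  have hy : ((N.pos a).im - (N.pos b).im) ^ 2 ≤ β ^ 2 := sq_le_sq' (by linarith) (by linarith)
  exact ⟨zero_le_one, by linarith⟩

theorem incidentGraph_adj {k : ℕ} {β δ : ℝ} {c : ℤ × ℤ} {a b : V} :
    (incidentGraph N k β δ c).Adj a b ↔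
      (N.ldel k).Adj a b ∧ (N.pos a ∈ cell β δ c ∨ N.pos b ∈ cell β δ c) := by
  rw [incidentGraph, SimpleGraph.fromRel_adj, (N.ldel k).adj_comm b a]
  constructor
  · rintro ⟨-, h | h⟩
    · exact ⟨h.1, .inl h.2⟩
    · exact ⟨h.1, .inr h.2⟩
  · rintro ⟨h, h' | h'⟩
    · exact ⟨h.ne, .inl ⟨h, h'⟩⟩
    · exact ⟨h.ne, .inr ⟨h, h'⟩⟩

/-- The nodes in a cell being a clique, an edge of the incident graph of the cell is within two
hops of each node in the cell. -/
theorem near_two_of_incidentGraph_adj {k : ℕ} {β δ : ℝ} (hβ : 0 < β) (hβ' : β ≤ 1 / √2)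
    {c : ℤ × ℤ} {z a b : V} (hz : N.pos z ∈ cell β δ c)
    (h : (incidentGraph N k β δ c).Adj a b) : N.Near 2 z a := by
  obtain ⟨h, ha | hb⟩ := incidentGraph_adj.1 h
  · exact (near_one_of_mem_cell hβ hβ' hz ha).mono (by norm_num)
  · exact (near_one_of_mem_cell hβ hβ' hz hb).trans (near_one_of_adj (udg_adj_of_ldel h).symm)

/-- The ordered Yao graph of the incident graph of a cell. -/
def cellYao [Finite V] (N : Network V) (k : ℕ) (β δ : ℝ) (rule : ConeRule) (c : ℤ × ℤ) :
    SimpleGraph V :=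
  yaoGraph N (incidentGraph N k β δ c) rule
    (exists_isYaoOrder N (incidentGraph N k β δ c)).choose

theorem isOrderedYao_cellYao [Finite V] (N : Network V) (k : ℕ) (β δ : ℝ) (rule : ConeRule)
    (c : ℤ × ℤ) :
    IsOrderedYao N (incidentGraph N k β δ c) rule (cellYao N k β δ rule c) :=
  ⟨_, (exists_isYaoOrder N (incidentGraph N k β δ c)).choose_spec, rfl⟩

/-- The graph `YDel`. -/
def yDel [Finite V] (N : Network V) (k : ℕ) (β δ : ℝ) (rule : ConeRule) : SimpleGraph V :=
  ⨆ c, cellYao N k β δ rule c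

theorem twoHop_yDel [Finite V] (k : ℕ) (β δ : ℝ) (rule : ConeRule) :
    N.TwoHop (yDel N k β δ rule) := by
  intro a b h
  obtain ⟨c, h⟩ := SimpleGraph.iSup_adj.1 h
  obtain ⟨v, ha, hb, -⟩ := exists_adj_of_yaoGraph_adj h
  have key : ∀ x, (v = x ∨ (incidentGraph N k β δ c).Adj v x) → N.Near 1 v x := by
    rintro x (rfl | h)
    · exact Near.refl _ _
    · exact near_one_of_adj (udg_adj_of_ldel (incidentGraph_adj.1 h).1)
  exact (key a ha).symm.trans (key b hb)

theorem exists_near_cell_of_cellYao_adj [Finite V] {k : ℕ} {β δ : ℝ} {rule : ConeRule}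
    {c : ℤ × ℤ} {a b : V} (h : (cellYao N k β δ rule c).Adj a b) :
    ∃ z, N.Near 1 a z ∧ N.pos z ∈ cell β δ c := by
  obtain ⟨-, -, -, y, h⟩ := exists_adj_of_yaoGraph_adj h
  obtain ⟨h, ha | hy⟩ := incidentGraph_adj.1 h
  · exact ⟨a, Near.refl _ _, ha⟩
  · exact ⟨y, near_one_of_adj (udg_adj_of_ldel h), hy⟩

namespace Network.IsSubnetwork

variable (hf : IsSubnetwork N' N f)
include hf

/-- Around a cell, the subnetwork sees the whole incident graph of the cell. -/
theorem isImageGraph_incidentGraph {k : ℕ} {β δ : ℝ} (hβ : 0 < β) (hβ' : β ≤ 1 / √2)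
    {c : ℤ × ℤ} {z : W} (hz : N'.pos z ∈ cell β δ c) (hc : N.Covers f z (k + 4)) :
    IsImageGraph f (incidentGraph N' k β δ c) (incidentGraph N k β δ c) := by
  have hz' : N.pos (f z) ∈ cell β δ c := by rwa [hf.pos_eq]
  have key : ∀ a b, N'.Near 2 z a →
      ((incidentGraph N' k β δ c).Adj a b ↔ (incidentGraph N k β δ c).Adj (f a) (f b)) := by
    intro a b ha
    rw [incidentGraph_adj, incidentGraph_adj, hf.pos_eq, hf.pos_eq,
      hf.ldel_adj (hf.covers_of_near (hc.mono (by omega : 2 + (k + 2) ≤ k + 4)) ha)]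
  refine ⟨fun a b => ⟨fun h => ?_, fun h => ?_⟩, fun x y h => ⟨?_, ?_⟩⟩
  · exact (key a b (near_two_of_incidentGraph_adj hβ hβ' hz h)).1 h
  · refine (key a b ?_).2 h
    exact (hf.near_iff (hc.mono (by omega))).1 (near_two_of_incidentGraph_adj hβ hβ' hz' h)
  · exact hc x ((near_two_of_incidentGraph_adj hβ hβ' hz' h).mono (by omega))
  · exact hc y ((near_two_of_incidentGraph_adj hβ hβ' hz' h.symm).mono (by omega))

theorem yDel_adj [Finite V] [Finite W] {k : ℕ} {β δ : ℝ} (hβ : 0 < β) (hβ' : β ≤ 1 / √2)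
    (rule : ConeRule) {a b : W} (hc : N.Covers f a (k + 5)) :
    (yDel N' k β δ rule).Adj a b ↔ (yDel N k β δ rule).Adj (f a) (f b) := by
  have key : ∀ c z, N'.Near 1 a z → N'.pos z ∈ cell β δ c →
      ((cellYao N' k β δ rule c).Adj a b ↔ (cellYao N k β δ rule c).Adj (f a) (f b)) := by
    intro c z haz hz
    have hG := hf.isImageGraph_incidentGraph hβ hβ' hz
      (hf.covers_of_near (hc.mono (by omega : 1 + (k + 4) ≤ k + 5)) haz)
    exact (hf.yaoGraph_adj_iff hG (IsYaoOrder.lt_iff_lt hf hG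
      (exists_isYaoOrder N' _).choose_spec (exists_isYaoOrder N _).choose_spec) rule a b).symm
  rw [yDel, yDel, SimpleGraph.iSup_adj, SimpleGraph.iSup_adj]
  refine exists_congr fun c => ⟨fun h => ?_, fun h => ?_⟩
  · obtain ⟨z, haz, hz⟩ := exists_near_cell_of_cellYao_adj h
    exact (key c z haz hz).1 h
  · obtain ⟨z, haz, hz⟩ := exists_near_cell_of_cellYao_adj h
    obtain ⟨z, rfl, haz'⟩ := hf.exists_near (hc.mono (by omega)) haz
    rw [hf.pos_eq] at hz
    exact (key c z haz' hz).2 h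

end Network.IsSubnetwork

end YDel

open Network

/-! ### Locality of the greedy filter on one cell -/

section Filter

variable {V : Type u} {W : Type w} {N : Network V} {N' : Network W} {f : W → V}

theorem edgeId_injective (N : Network V) : Function.Injective N.edgeId := by
  have key : ∀ a b c d : V, N.dirEdgeId a b = N.dirEdgeId c d → a = c ∧ b = d := by
    intro a b c d h
    have h' := congrArg (fun p => ofLex (ofLex p).2) h
    exact ⟨N.ident_injective (congrArg Prod.fst h'), N.ident_injective (congrArg Prod.snd h')⟩
  intro e e'
  induction e with | _ a b
  induction e' with | _ c d
  intro h
  simp only [edgeId, Sym2.lift_mk] at h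
  rcases min_choice (N.dirEdgeId a b) (N.dirEdgeId b a) with h1 | h1 <;>
  rcases min_choice (N.dirEdgeId c d) (N.dirEdgeId d c) with h2 | h2 <;>
  · rw [h1, h2] at h
    obtain ⟨rfl, rfl⟩ := key _ _ _ _ h
    first | rfl | exact Sym2.eq_swap

/-- The graph that the query for `e` adds to `Q`: the edge `e`, or nothing. -/
def queryGraph (N : Network V) (ε : ℝ) (Q : SimpleGraph V) (e : Sym2 V) : SimpleGraph V :=
  (query N ε (Q, ⊥) e).2

theorem query_eq (ε : ℝ) (S : SimpleGraph V × SimpleGraph V) (e : Sym2 V) :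
    query N ε S e = (S.1 ⊔ queryGraph N ε S.1 e, S.2 ⊔ queryGraph N ε S.1 e) := by
  unfold queryGraph query
  split_ifs <;> simp

theorem queryGraph_adj {ε : ℝ} {Q : SimpleGraph V} {u v a b : V} :
    (queryGraph N ε Q s(u, v)).Adj a b ↔
      ¬ N.sp Q u v ≤ ENNReal.ofReal ((1 + ε) * N.len u v) ∧ s(a, b) = s(u, v) ∧ a ≠ b := by
  have hcond : (∃ x y, s(u, v) = s(x, y) ∧
      ENNReal.ofReal ((1 + ε) * N.len x y) < N.sp Q x y) ↔
      ¬ N.sp Q u v ≤ ENNReal.ofReal ((1 + ε) * N.len u v) := by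
    rw [not_le]
    constructor
    · rintro ⟨x, y, h, hlt⟩
      rcases Sym2.eq_iff.1 h with ⟨rfl, rfl⟩ | ⟨rfl, rfl⟩
      · exact hlt
      · rwa [sp_comm, len_comm]
    · exact fun h => ⟨u, v, rfl, h⟩
  unfold queryGraph query
  rw [hcond]
  split_ifs with h <;> simp [h]

/-- The queries do not look at `H`, so the edges they add are the same for every initial `H`. -/
theorem foldl_query_eq (ε : ℝ) (L : List (Sym2 V)) (Q H : SimpleGraph V) :
    L.foldl (query N ε) (Q, H) =
      (Q ⊔ (L.foldl (query N ε) (Q, ⊥)).2, H ⊔ (L.foldl (query N ε) (Q, ⊥)).2) := by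
  induction L generalizing Q H with
  | nil => simp
  | cons e L ih =>
    simp only [List.foldl_cons, query_eq]
    rw [ih, ih (H := ⊥ ⊔ _)]
    simp [sup_assoc]

theorem mem_of_foldl_query_adj {ε : ℝ} {L : List (Sym2 V)} {Q H : SimpleGraph V} {a b : V}
    (h : (L.foldl (query N ε) (Q, H)).2.Adj a b) : H.Adj a b ∨ s(a, b) ∈ L := by
  induction L generalizing Q H with
  | nil => exact .inl h
  | cons e L ih =>
    rw [List.foldl_cons, query_eq] at h
    rcases ih h with h | h
    · rcases h with h | h
      · exact .inl h
      · induction e with | _ u v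
        exact .inr (by simp [(queryGraph_adj.1 h).2.1])
    · exact .inr (List.mem_cons_of_mem _ h)

variable [Finite V] [Finite W]

theorem mem_sortedCellEdges {β δ : ℝ} {c : ℤ × ℤ} {Q : SimpleGraph V} {e : Sym2 V} :
    e ∈ sortedCellEdges N β δ c Q ↔ e ∈ cellEdges N β δ c Q := by
  simp [sortedCellEdges]

theorem pairwise_sortedCellEdges (N : Network V) (β δ : ℝ) (c : ℤ × ℤ) (Q : SimpleGraph V) :
    (sortedCellEdges N β δ c Q).Pairwise fun e e' => N.edgeId e ≤ N.edgeId e' := by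
  classical
  have := List.pairwise_mergeSort (le := fun e e' => decide (N.edgeId e ≤ N.edgeId e'))
    (fun _ _ _ => by simpa using le_trans) (fun _ _ => by simpa using le_total _ _)
    (cellEdges N β δ c Q).toFinite.toFinset.toList
  simpa [sortedCellEdges] using this

omit [Finite V] in
theorem mk_mem_cellEdges {β δ : ℝ} {c : ℤ × ℤ} {Q : SimpleGraph V} {a b : V} :
    s(a, b) ∈ cellEdges N β δ c Q ↔
      Q.Adj a b ∧ N.pos a ∈ cell β δ c ∧ N.pos b ∈ cell β δ c := by
  simp [cellEdges]

/-- The edges that the greedy filter keeps in the cell `c`. -/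
def keptGraph (N : Network V) (ε β δ : ℝ) (Q : SimpleGraph V) (c : ℤ × ℤ) : SimpleGraph V :=
  (processCell N ε β δ (Q, ⊥) c).2

theorem processCell_eq (ε β δ : ℝ) (S : SimpleGraph V × SimpleGraph V) (c : ℤ × ℤ) :
    processCell N ε β δ S c =
      (S.1.deleteEdges (cellEdges N β δ c S.1) ⊔ keptGraph N ε β δ S.1 c,
        S.2 ⊔ keptGraph N ε β δ S.1 c) := by
  unfold keptGraph processCell
  rw [foldl_query_eq]

theorem keptGraph_adj_imp {ε β δ : ℝ} {Q : SimpleGraph V} {c : ℤ × ℤ} {a b : V}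
    (h : (keptGraph N ε β δ Q c).Adj a b) :
    Q.Adj a b ∧ N.pos a ∈ cell β δ c ∧ N.pos b ∈ cell β δ c := by
  unfold keptGraph processCell at h
  rcases mem_of_foldl_query_adj h with h | h
  · exact h.elim
  · exact mk_mem_cellEdges.1 (mem_sortedCellEdges.1 h)

theorem processCell_fst_adj {ε β δ : ℝ} {S : SimpleGraph V × SimpleGraph V} {c : ℤ × ℤ}
    {a b : V} : (processCell N ε β δ S c).1.Adj a b ↔ S.1.Adj a b ∧
      (N.pos a ∈ cell β δ c → N.pos b ∈ cell β δ c → (keptGraph N ε β δ S.1 c).Adj a b) := by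
  rw [processCell_eq, SimpleGraph.sup_adj, SimpleGraph.deleteEdges_adj, mk_mem_cellEdges]
  constructor
  · rintro (⟨h, h'⟩ | h)
    · exact ⟨h, fun ha hb => absurd ⟨h, ha, hb⟩ h'⟩
    · exact ⟨(keptGraph_adj_imp h).1, fun _ _ => h⟩
  · rintro ⟨h, h'⟩
    by_cases hc : N.pos a ∈ cell β δ c ∧ N.pos b ∈ cell β δ c
    · exact .inr (h' hc.1 hc.2)
    · exact .inl ⟨h, fun h => hc h.2⟩

namespace Network.IsSubnetwork

variable (hf : IsSubnetwork N' N f)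
include hf

omit [Finite V] [Finite W] in
theorem edgeId_map_eq (e : Sym2 W) : N.edgeId (e.map f) = N'.edgeId e := by
  induction e with | _ a b
  exact hf.edgeId_mk_eq a b

omit [Finite V] [Finite W] in
theorem cellEdges_eq {β δ : ℝ} (hβ : 0 < β) (hβ' : β ≤ 1 / √2) {c : ℤ × ℤ} {a : W}
    (ha : N'.pos a ∈ cell β δ c) (hc : N.Covers f a 1) {Q' : SimpleGraph W}
    {Q : SimpleGraph V} (hag : AgreeNear N' f Q' Q a 1) :
    cellEdges N β δ c Q = Sym2.map f '' cellEdges N' β δ c Q' := by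
  have hnear : ∀ x, N.pos x ∈ cell β δ c → x ∈ Set.range f := fun x hx =>
    hc x (near_one_of_mem_cell hβ hβ' (by rwa [hf.pos_eq]) hx)
  ext e
  constructor
  · intro he
    induction e with | _ x y
    obtain ⟨hxy, hx, hy⟩ := mk_mem_cellEdges.1 he
    obtain ⟨x, rfl⟩ := hnear x hx
    obtain ⟨y, rfl⟩ := hnear y hy
    rw [hf.pos_eq] at hx hy
    exact ⟨s(x, y), mk_mem_cellEdges.2
      ⟨(hag x y (near_one_of_mem_cell hβ hβ' ha hx)).2 hxy, hx, hy⟩, rfl⟩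
  · rintro ⟨e, he, rfl⟩
    induction e with | _ x y
    obtain ⟨hxy, hx, hy⟩ := mk_mem_cellEdges.1 he
    exact mk_mem_cellEdges.2
      ⟨(hag x y (near_one_of_mem_cell hβ hβ' ha hx)).1 hxy, by rwa [hf.pos_eq], by rwa [hf.pos_eq]⟩

/-- Edge identifiers being distinct, there is only one way to sort the edges. -/
theorem sortedCellEdges_eq {β δ : ℝ} (hβ : 0 < β) (hβ' : β ≤ 1 / √2) {c : ℤ × ℤ} {a : W}
    (ha : N'.pos a ∈ cell β δ c) (hc : N.Covers f a 1) {Q' : SimpleGraph W}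
    {Q : SimpleGraph V} (hag : AgreeNear N' f Q' Q a 1) :
    sortedCellEdges N β δ c Q = (sortedCellEdges N' β δ c Q').map (Sym2.map f) := by
  classical
  have hset := hf.cellEdges_eq hβ hβ' ha hc hag
  have hnodup : (sortedCellEdges N β δ c Q).Nodup :=
    (List.mergeSort_perm _ _).nodup_iff.2 (Finset.nodup_toList _)
  have hnodup' : (sortedCellEdges N' β δ c Q').Nodup :=
    (List.mergeSort_perm _ _).nodup_iff.2 (Finset.nodup_toList _)
  refine List.Perm.eq_of_pairwise (le := fun e e' => N.edgeId e ≤ N.edgeId e')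
    (fun e e' _ _ h h' => edgeId_injective N (le_antisymm h h'))
    (pairwise_sortedCellEdges N β δ c Q) ?_ ?_
  · rw [List.pairwise_map]
    simpa only [hf.edgeId_map_eq] using pairwise_sortedCellEdges N' β δ c Q'
  · rw [List.perm_ext_iff_of_nodup hnodup (hnodup'.map (Sym2.map.injective hf.injective))]
    intro e
    rw [mem_sortedCellEdges, hset]
    simp [mem_sortedCellEdges]

omit [Finite V] [Finite W] in
theorem queryGraph_adj_iff {ε β δ X : ℝ} (hε : 0 ≤ ε) (hβ : 0 < β) (hβ' : β ≤ 1 / √2)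
    (hX : 1 + ε < X) {D : ℕ} (hD : 3 * X + 1 ≤ D) {c : ℤ × ℤ}
    {Q' : SimpleGraph W} {Q : SimpleGraph V} (hQ' : N'.TwoHop Q') (hQ : N.TwoHop Q)
    {u v : W} (hu : N'.pos u ∈ cell β δ c) (hv : N'.pos v ∈ cell β δ c)
    (hc : N.Covers f u D) (hag : AgreeNear N' f Q' Q u D) (x y : W) :
    (queryGraph N' ε Q' s(u, v)).Adj x y ↔ (queryGraph N ε Q s(f u, f v)).Adj (f x) (f y) := by
  have hlen : N'.len u v ≤ 1 := by simpa using (near_one_of_mem_cell hβ hβ' hu hv).len_le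
  have h0 := N'.len_nonneg u v
  have hlt : (1 + ε) * N'.len u v < X :=
    lt_of_le_of_lt (mul_le_of_le_one_right (by linarith) hlen) hX
  rw [queryGraph_adj, queryGraph_adj, hf.len_eq,
    ← hf.sp_le_iff hQ' hQ (mul_nonneg (by linarith) h0) hlt hD hc hag, hf.injective.ne_iff]
  refine and_congr_right fun _ => and_congr_left fun _ => ?_
  change _ ↔ Sym2.map f s(x, y) = Sym2.map f s(u, v)
  exact (Sym2.map.injective hf.injective).eq_iff.symm

omit [Finite V] [Finite W] in
theorem agreeNear_foldl_query {ε β δ X : ℝ} (hε : 0 ≤ ε) (hβ : 0 < β) (hβ' : β ≤ 1 / √2)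
    (hX : 1 + ε < X) {D : ℕ} (hD : 3 * X + 1 ≤ D) {c : ℤ × ℤ} {a : W}
    (ha : N'.pos a ∈ cell β δ c) (hc : N.Covers f a (1 + D)) (L : List (Sym2 W))
    (hL : ∀ e ∈ L, ∀ x ∈ e, N'.pos x ∈ cell β δ c)
    {Q' H' : SimpleGraph W} {Q H : SimpleGraph V} (hQ' : N'.TwoHop Q') (hQ : N.TwoHop Q)
    (hagQ : AgreeNear N' f Q' Q a (1 + D)) (hagH : AgreeNear N' f H' H a (1 + D)) :
    AgreeNear N' f (L.foldl (query N' ε) (Q', H')).2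
      ((L.map (Sym2.map f)).foldl (query N ε) (Q, H)).2 a (1 + D) := by
  induction L generalizing Q' H' Q H with
  | nil => exact hagH
  | cons e L ih =>
    induction e with | _ u v
    have hu := hL s(u, v) (by simp) u (by simp)
    have hv := hL s(u, v) (by simp) v (by simp)
    have hau := near_one_of_mem_cell hβ hβ' ha hu
    have key := hf.queryGraph_adj_iff hε hβ hβ' hX hD hQ' hQ hu hv (hf.covers_of_near hc hau)
      (fun x y hx => hagQ x y (hau.trans hx))
    have huv' := near_one_of_mem_cell hβ hβ' hu hv
    have huv := hf.near_map huv'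
    rw [List.map_cons, List.foldl_cons, List.foldl_cons, query_eq, query_eq]
    refine ih (fun e he => hL e (List.mem_cons_of_mem _ he)) ?_ ?_ ?_ ?_
    · rintro x y (h | h)
      · exact hQ' x y h
      · rcases Sym2.eq_iff.1 (queryGraph_adj.1 h).2.1 with ⟨rfl, rfl⟩ | ⟨rfl, rfl⟩
        · exact huv'.mono one_le_two
        · exact huv'.symm.mono one_le_two
    · rintro x y (h | h)
      · exact hQ x y h
      · rcases Sym2.eq_iff.1 (queryGraph_adj.1 h).2.1 with ⟨rfl, rfl⟩ | ⟨rfl, rfl⟩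
        · exact huv.mono one_le_two
        · exact huv.symm.mono one_le_two
    · exact fun x y hx => or_congr (hagQ x y hx) (key x y)
    · exact fun x y hx => or_congr (hagH x y hx) (key x y)

/-- The greedy filter on a cell depends only on the graph near the cell. -/
theorem keptGraph_adj_iff {ε β δ X : ℝ} (hε : 0 ≤ ε) (hβ : 0 < β) (hβ' : β ≤ 1 / √2)
    (hX : 1 + ε < X) {D : ℕ} (hD : 3 * X + 1 ≤ D) {c : ℤ × ℤ} {a b : W}
    (ha : N'.pos a ∈ cell β δ c) (hc : N.Covers f a (1 + D))
    {Q' : SimpleGraph W} {Q : SimpleGraph V} (hQ' : N'.TwoHop Q') (hQ : N.TwoHop Q)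
    (hag : AgreeNear N' f Q' Q a (1 + D)) :
    (keptGraph N' ε β δ Q' c).Adj a b ↔ (keptGraph N ε β δ Q c).Adj (f a) (f b) := by
  have hag1 : AgreeNear N' f Q' Q a 1 := fun x y hx => hag x y (hx.mono (by omega))
  unfold keptGraph processCell
  rw [hf.sortedCellEdges_eq hβ hβ' ha (hc.mono (by omega)) hag1]
  refine hf.agreeNear_foldl_query hε hβ hβ' hX hD ha hc _ (fun e he => ?_)
    (hQ'.mono (SimpleGraph.deleteEdges_le _)) (hQ.mono (SimpleGraph.deleteEdges_le _))
    (fun x y hx => ?_) (fun x y hx => by simp) a b (Near.refl _ _)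
  · exact (mem_sortedCellEdges.1 he).2
  · rw [SimpleGraph.deleteEdges_adj, SimpleGraph.deleteEdges_adj, mk_mem_cellEdges,
      mk_mem_cellEdges, hag x y hx, hf.pos_eq, hf.pos_eq]

end Network.IsSubnetwork

end Filter

/-! ### Colors of cells -/

section Color

/-- A coloring of the cells that refines their classes: it also records both indices modulo
`M`. -/
def cellColor (M : ℕ) (c : ℤ × ℤ) : ℕ :=
  ((cellClass c * M + c.1 % M) * M + c.2 % M).toNat

variable {M : ℕ} (hM : 0 < M)
include hM

theorem cast_cellColor (c : ℤ × ℤ) :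
    (cellColor M c : ℤ) = (cellClass c * M + c.1 % M) * M + c.2 % M := by
  have h0 : 0 ≤ cellClass c := by unfold cellClass; omega
  have h1 := Int.emod_nonneg c.1 (by omega : (M : ℤ) ≠ 0)
  have h2 := Int.emod_nonneg c.2 (by omega : (M : ℤ) ≠ 0)
  exact Int.toNat_of_nonneg (by positivity)

theorem cellColor_div (c : ℤ × ℤ) :
    (cellColor M c : ℤ) / M = cellClass c * M + c.1 % M ∧ (cellColor M c : ℤ) % M = c.2 % M ∧
      (cellColor M c : ℤ) / M / M = cellClass c ∧ (cellColor M c : ℤ) / M % M = c.1 % M := by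
  have hM' : (0 : ℤ) < M := by exact_mod_cast hM
  have h1 := Int.emod_nonneg c.1 hM'.ne'
  have h1' := Int.emod_lt_of_pos c.1 hM'
  have h2 := Int.emod_nonneg c.2 hM'.ne'
  have h2' := Int.emod_lt_of_pos c.2 hM'
  have hdiv : (cellColor M c : ℤ) / M = cellClass c * M + c.1 % M := by
    rw [cast_cellColor hM, add_comm, Int.add_mul_ediv_right _ _ hM'.ne',
      Int.ediv_eq_zero_of_lt h2 h2', zero_add]
  refine ⟨hdiv, ?_, ?_, ?_⟩
  · rw [cast_cellColor hM, add_comm, Int.add_mul_emod_self_right, Int.emod_emod]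
  · rw [hdiv, add_comm, Int.add_mul_ediv_right _ _ hM'.ne', Int.ediv_eq_zero_of_lt h1 h1',
      zero_add]
  · rw [hdiv, add_comm, Int.add_mul_emod_self_right, Int.emod_emod]

theorem cellClass_le_of_cellColor_le {c c' : ℤ × ℤ} (h : cellColor M c ≤ cellColor M c') :
    cellClass c ≤ cellClass c' := by
  rw [← (cellColor_div hM c).2.2.1, ← (cellColor_div hM c').2.2.1]
  exact Int.ediv_le_ediv (by omega) (Int.ediv_le_ediv (by omega) (by exact_mod_cast h))

theorem cellColor_lt (c : ℤ × ℤ) : cellColor M c < 4 * M * M := by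
  have hM' : (0 : ℤ) < M := by exact_mod_cast hM
  have h0 : cellClass c < 4 := by unfold cellClass; omega
  rw [← (cellColor_div hM c).2.2.1] at h0
  have h1 := (Int.ediv_lt_iff_lt_mul hM').1 ((Int.ediv_lt_iff_lt_mul hM').1 h0)
  exact_mod_cast h1

/-- Two distinct cells of the same color are far apart. -/
theorem lt_dist_of_cellColor_eq {β δ D : ℝ} (hδ : δ < β / 4) (hβ : 0 < β)
    (hMD : D + β < M * (β - 2 * δ)) {c c' : ℤ × ℤ} (hne : c ≠ c')
    (h : cellColor M c = cellColor M c') {x y : ℂ} (hx : x ∈ cell β δ c)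
    (hy : y ∈ cell β δ c') : D < dist x y := by
  have hs : 0 < β - 2 * δ := by linarith
  have key : ∀ i j : ℤ, i ≠ j → i % M = j % M → ∀ p q : ℝ, i * (β - 2 * δ) ≤ p →
      p < i * (β - 2 * δ) + β → j * (β - 2 * δ) ≤ q → q < j * (β - 2 * δ) + β → D < |p - q| := by
    intro i j hij hmod p q hp hp' hq hq'
    have hdvd : (M : ℤ) ∣ i - j := (show j ≡ i [ZMOD M] from hmod.symm).dvd
    have habs := Int.le_of_dvd (abs_pos.2 (sub_ne_zero.2 hij)) ((dvd_abs _ _).2 hdvd)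
    have habs' : (M : ℝ) ≤ |(i : ℝ) - j| := by exact_mod_cast habs
    rcases le_total (0 : ℝ) ((i : ℝ) - j) with h0 | h0
    · rw [abs_of_nonneg h0] at habs'
      have := mul_le_mul_of_nonneg_right habs' hs.le
      exact lt_of_lt_of_le (by linarith) (le_abs_self _)
    · rw [abs_of_nonpos h0] at habs'
      have := mul_le_mul_of_nonneg_right habs' hs.le
      exact lt_of_lt_of_le (by linarith) (neg_le_abs _)
  obtain ⟨x1, x2, x3, x4⟩ := hx
  obtain ⟨y1, y2, y3, y4⟩ := hy
  have h1 : c.1 % M = c'.1 % M := by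
    rw [← (cellColor_div hM c).2.2.2, ← (cellColor_div hM c').2.2.2, h]
  have h2 : c.2 % M = c'.2 % M := by
    rw [← (cellColor_div hM c).2.1, ← (cellColor_div hM c').2.1, h]
  by_cases hc1 : c.1 = c'.1
  · have hc2 : c.2 ≠ c'.2 := fun hc2 => hne (Prod.ext hc1 hc2)
    have := key _ _ hc2 h2 _ _ x3 x4 y3 y4
    rw [← Complex.sub_im] at this
    exact this.trans_le (by rw [dist_eq_norm]; exact Complex.abs_im_le_norm _)
  · have := key _ _ hc1 h1 _ _ x1 x2 y1 y2
    rw [← Complex.sub_re] at this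
    exact this.trans_le (by rw [dist_eq_norm]; exact Complex.abs_re_le_norm _)

end Color

/-! ### Locality of the greedy filter on all cells -/

section Fold

variable {V : Type u} {W : Type w} {N : Network V} {N' : Network W} {f : W → V}

theorem finite_cells_of_mem {β δ : ℝ} (hs : 0 < β - 2 * δ) (z : ℂ) :
    {c | z ∈ cell β δ c}.Finite := by
  refine ((Set.finite_Icc ⌊(z.re - β) / (β - 2 * δ)⌋ ⌊z.re / (β - 2 * δ)⌋).prod
    (Set.finite_Icc ⌊(z.im - β) / (β - 2 * δ)⌋ ⌊z.im / (β - 2 * δ)⌋)).subset ?_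
  have key : ∀ (i : ℤ) (p : ℝ), i * (β - 2 * δ) ≤ p → p < i * (β - 2 * δ) + β →
      i ∈ Set.Icc ⌊(p - β) / (β - 2 * δ)⌋ ⌊p / (β - 2 * δ)⌋ := by
    intro i p h h'
    refine ⟨?_, Int.le_floor.2 ((le_div_iff₀ hs).2 h)⟩
    have : (p - β) / (β - 2 * δ) < i := (div_lt_iff₀ hs).2 (by linarith)
    exact_mod_cast (Int.floor_le _).trans this.le
  rintro c ⟨h1, h2, h3, h4⟩
  exact ⟨key _ _ h1 h2, key _ _ h3 h4⟩

variable [Finite V] [Finite W]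

theorem finite_cells {β δ : ℝ} (hs : 0 < β - 2 * δ) (N : Network V) (M j : ℕ) :
    {c | cellColor M c = j ∧ ∃ v, N.pos v ∈ cell β δ c}.Finite := by
  refine (Set.finite_iUnion fun v => finite_cells_of_mem hs (N.pos v)).subset ?_
  rintro c ⟨-, v, hv⟩
  exact Set.mem_iUnion.2 ⟨v, hv⟩

open Classical in
/-- The nonempty cells of color `j`, in an arbitrary order; the value `[]` is junk, for parameters
for which there may be infinitely many nonempty cells. -/
def colorBlock (N : Network V) (β δ : ℝ) (M j : ℕ) : List (ℤ × ℤ) :=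
  if hs : 0 < β - 2 * δ then (finite_cells hs N M j).toFinset.toList else []

theorem mem_colorBlock {β δ : ℝ} (hs : 0 < β - 2 * δ) {M j : ℕ} {c : ℤ × ℤ} :
    c ∈ colorBlock N β δ M j ↔ cellColor M c = j ∧ ∃ v, N.pos v ∈ cell β δ c := by
  simp [colorBlock, hs]

theorem nodup_colorBlock (N : Network V) (β δ : ℝ) (M j : ℕ) :
    (colorBlock N β δ M j).Nodup := by
  unfold colorBlock
  split_ifs
  · exact Finset.nodup_toList _
  · exact List.nodup_nil

/-- The nonempty cells of the colors `0, …, n - 1`, by increasing color. -/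
def cellsUpTo (N : Network V) (β δ : ℝ) (M n : ℕ) : List (ℤ × ℤ) :=
  (List.range n).flatMap (colorBlock N β δ M)

theorem isCellOrder_cellsUpTo {β δ : ℝ} (hs : 0 < β - 2 * δ) {M : ℕ} (hM : 0 < M) :
    IsCellOrder N β δ (cellsUpTo N β δ M (4 * M * M)) := by
  refine ⟨List.nodup_flatMap.2 ⟨fun j _ => nodup_colorBlock N β δ M j, ?_⟩, fun c => ?_,
    List.pairwise_flatMap.2 ⟨fun j _ => ?_, ?_⟩⟩
  · refine List.pairwise_lt_range.imp fun {i j} hij => ?_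
    intro c hi hj
    rw [mem_colorBlock hs] at hi hj
    omega
  · rw [cellsUpTo, List.mem_flatMap]
    constructor
    · rintro ⟨j, -, h⟩
      exact ((mem_colorBlock hs).1 h).2
    · exact fun h => ⟨_, List.mem_range.2 (cellColor_lt hM c), (mem_colorBlock hs).2 ⟨rfl, h⟩⟩
  · refine (List.pairwise_of_forall_mem_list ?_)
    intro c hc c' hc'
    rw [mem_colorBlock hs] at hc hc'
    exact cellClass_le_of_cellColor_le hM (by omega)
  · refine List.pairwise_lt_range.imp fun {i j} hij c hc c' hc' => ?_
    rw [mem_colorBlock hs] at hc hc'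
    exact cellClass_le_of_cellColor_le hM (by omega)

/-- On cells that are far apart from each other, the greedy filter may be run in parallel. -/
theorem foldl_processCell_adj {ε β δ X : ℝ} (hε : 0 ≤ ε) (hβ : 0 < β) (hβ' : β ≤ 1 / √2)
    (hX : 1 + ε < X) {D : ℕ} (hD : 3 * X + 1 ≤ D) (L : List (ℤ × ℤ))
    (hL : L.Pairwise fun c c' => ∀ x y, N.pos x ∈ cell β δ c → N.pos y ∈ cell β δ c' →
      ((1 + D : ℕ) : ℝ) < N.len x y)
    (S : SimpleGraph V × SimpleGraph V) (hS : N.TwoHop S.1) (a b : V) :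
    ((L.foldl (processCell N ε β δ) S).1.Adj a b ↔ S.1.Adj a b ∧ ∀ c ∈ L,
      N.pos a ∈ cell β δ c → N.pos b ∈ cell β δ c → (keptGraph N ε β δ S.1 c).Adj a b) ∧
    ((L.foldl (processCell N ε β δ) S).2.Adj a b ↔ S.2.Adj a b ∨ ∃ c ∈ L,
      (keptGraph N ε β δ S.1 c).Adj a b) := by
  induction L generalizing S with
  | nil => simp
  | cons c L ih =>
    obtain ⟨hc, hL⟩ := List.pairwise_cons.1 hL
    have hle : (processCell N ε β δ S c).1 ≤ S.1 := fun x y h => (processCell_fst_adj.1 h).1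
    have hkept : ∀ c' ∈ L, (keptGraph N ε β δ (processCell N ε β δ S c).1 c').Adj a b ↔
        (keptGraph N ε β δ S.1 c').Adj a b := by
      intro c' hc'
      have key : N.pos a ∈ cell β δ c' →
          ((keptGraph N ε β δ (processCell N ε β δ S c).1 c').Adj a b ↔
            (keptGraph N ε β δ S.1 c').Adj a b) := by
        intro ha
        refine (isSubnetwork_id N).keptGraph_adj_iff hε hβ hβ' hX hD ha (covers_id _ _)
          (hS.mono hle) hS fun x y hx => ?_
        rw [processCell_fst_adj]
        refine and_iff_left fun hxc => absurd (hc c' hc' x a hxc ha) (not_lt.2 ?_)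
        exact hx.symm.len_le
      exact ⟨fun h => (key (keptGraph_adj_imp h).2.1).1 h,
        fun h => (key (keptGraph_adj_imp h).2.1).2 h⟩
    obtain ⟨ih1, ih2⟩ := ih hL (processCell N ε β δ S c) (hS.mono hle)
    rw [List.foldl_cons, ih1, ih2]
    constructor
    · rw [processCell_fst_adj, List.forall_mem_cons, and_assoc]
      refine and_congr_right fun _ => and_congr_right fun _ => forall₂_congr fun c' hc' => ?_
      rw [hkept c' hc']
    · rw [processCell_eq, SimpleGraph.sup_adj, List.exists_mem_cons_iff, or_assoc]
      rw [processCell_eq] at hkept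
      refine or_congr_right (or_congr_right (exists_congr fun c' => and_congr_right fun hc' => ?_))
      exact hkept c' hc'

/-- The pair of the current `YDel` and `H` after the cells of the first `n` colors. -/
def filterState (N : Network V) (k : ℕ) (ε β δ : ℝ) (rule : ConeRule) (M n : ℕ) :
    SimpleGraph V × SimpleGraph V :=
  (cellsUpTo N β δ M n).foldl (processCell N ε β δ) (yDel N k β δ rule, ⊥)

theorem filterState_succ (k : ℕ) (ε β δ : ℝ) (rule : ConeRule) (M n : ℕ) :
    filterState N k ε β δ rule M (n + 1) = (colorBlock N β δ M n).foldl (processCell N ε β δ)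
      (filterState N k ε β δ rule M n) := by
  simp [filterState, cellsUpTo, List.range_succ]

theorem filterState_le (k : ℕ) (ε β δ : ℝ) (rule : ConeRule) (M n : ℕ) :
    (filterState N k ε β δ rule M n).1 ≤ yDel N k β δ rule ∧
      (filterState N k ε β δ rule M n).2 ≤ yDel N k β δ rule := by
  unfold filterState
  have key : ∀ (Y : SimpleGraph V) (L : List (ℤ × ℤ)) (S : SimpleGraph V × SimpleGraph V),
      S.1 ≤ Y ∧ S.2 ≤ Y → (L.foldl (processCell N ε β δ) S).1 ≤ Y ∧
        (L.foldl (processCell N ε β δ) S).2 ≤ Y := by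
    intro Y L
    induction L with
    | nil => exact fun S h => h
    | cons c L ih =>
      refine fun S h => ih _ ⟨fun a b hab => h.1 (processCell_fst_adj.1 hab).1, ?_⟩
      rw [processCell_eq]
      exact sup_le h.2 fun a b hab => h.1 (keptGraph_adj_imp hab).1
  exact key _ _ _ ⟨le_rfl, bot_le⟩

theorem pos_of_lt_mul {β δ : ℝ} {D M : ℕ} (hβ : 0 < β)
    (hM : ((1 + D : ℕ) : ℝ) + β < M * (β - 2 * δ)) : 0 < M := by
  rcases Nat.eq_zero_or_pos M with rfl | h
  · have : (0 : ℝ) ≤ ((1 + D : ℕ) : ℝ) := Nat.cast_nonneg _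
    simp only [Nat.cast_zero, zero_mul] at hM
    linarith
  · exact h

theorem filterState_succ_adj (N : Network V) {ε β δ X : ℝ} (hε : 0 ≤ ε)
    (hβ : 0 < β) (hβ' : β ≤ 1 / √2) (hδ : δ < β / 4) (hX : 1 + ε < X) {D : ℕ}
    (hD : 3 * X + 1 ≤ D) {M : ℕ} (hM : ((1 + D : ℕ) : ℝ) + β < M * (β - 2 * δ))
    (k : ℕ) (rule : ConeRule) (n : ℕ) (a b : V) :
    ((filterState N k ε β δ rule M (n + 1)).1.Adj a b ↔
      (filterState N k ε β δ rule M n).1.Adj a b ∧ ∀ c ∈ colorBlock N β δ M n,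
        N.pos a ∈ cell β δ c → N.pos b ∈ cell β δ c →
          (keptGraph N ε β δ (filterState N k ε β δ rule M n).1 c).Adj a b) ∧
    ((filterState N k ε β δ rule M (n + 1)).2.Adj a b ↔
      (filterState N k ε β δ rule M n).2.Adj a b ∨ ∃ c ∈ colorBlock N β δ M n,
        (keptGraph N ε β δ (filterState N k ε β δ rule M n).1 c).Adj a b) := by
  have hs : 0 < β - 2 * δ := by linarith
  rw [filterState_succ]
  refine foldl_processCell_adj hε hβ hβ' hX hD _ ((nodup_colorBlock N β δ M n).imp_of_mem
    fun {c c'} hc hc' hne x y hx hy => ?_) _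
    ((twoHop_yDel k β δ rule).mono (filterState_le k ε β δ rule M n).1) a b
  rw [mem_colorBlock hs] at hc hc'
  exact lt_dist_of_cellColor_eq (pos_of_lt_mul hβ hM) hδ hβ hM hne (hc.1.trans hc'.1.symm) hx hy

/-- The graphs `G'` and `G` agree at all nodes of the subnetwork around which it contains all nodes
within `t` hops. -/
def LocalAgree (N : Network V) (f : W → V) (G' : SimpleGraph W) (G : SimpleGraph V) (t : ℕ) :
    Prop :=
  ∀ a b, N.Covers f a t → (G'.Adj a b ↔ G.Adj (f a) (f b))

omit [Finite V] [Finite W] in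
theorem LocalAgree.agreeNear (hf : IsSubnetwork N' N f) {G' : SimpleGraph W} {G : SimpleGraph V}
    {s t : ℕ} (h : LocalAgree N f G' G t) {a : W} (hc : N.Covers f a (s + t)) :
    AgreeNear N' f G' G a s := fun x y hx => h x y (hf.covers_of_near hc hx)

/-- Each color adds `1 + D` to the radius: one hop within the cell that contains an edge, and `D`
hops for the paths in the queries. -/
theorem localAgree_filterState (hf : IsSubnetwork N' N f) {ε β δ X : ℝ} (hε : 0 ≤ ε)
    (hβ : 0 < β) (hβ' : β ≤ 1 / √2) (hδ : δ < β / 4) (hX : 1 + ε < X) {D : ℕ}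
    (hD : 3 * X + 1 ≤ D) {M : ℕ} (hM : ((1 + D : ℕ) : ℝ) + β < M * (β - 2 * δ))
    (k : ℕ) (rule : ConeRule) (n : ℕ) :
    LocalAgree N f (filterState N' k ε β δ rule M n).1 (filterState N k ε β δ rule M n).1
      (k + 5 + n * (1 + D)) ∧
    LocalAgree N f (filterState N' k ε β δ rule M n).2 (filterState N k ε β δ rule M n).2
      (k + 5 + n * (1 + D)) := by
  have hs : 0 < β - 2 * δ := by linarith
  induction n with
  | zero =>
    refine ⟨fun a b hc => ?_, fun a b hc => ?_⟩
    · simpa [filterState, cellsUpTo] using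
        hf.yDel_adj hβ hβ' rule (hc.mono (by omega : k + 5 ≤ k + 5 + 0 * (1 + D)))
    · simp [filterState, cellsUpTo]
  | succ n ih =>
    have hsum : k + 5 + (n + 1) * (1 + D) = 1 + D + (k + 5 + n * (1 + D)) := by ring
    have hmem : ∀ (a : W) (c : ℤ × ℤ), N'.pos a ∈ cell β δ c →
        (c ∈ colorBlock N' β δ M n ↔ c ∈ colorBlock N β δ M n) := by
      intro a c ha
      rw [mem_colorBlock hs, mem_colorBlock hs]
      exact and_congr_right fun _ =>
        ⟨fun _ => ⟨f a, by rwa [hf.pos_eq]⟩, fun _ => ⟨a, ha⟩⟩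
    have hkept : ∀ (a b : W) (c : ℤ × ℤ), N.Covers f a (1 + D + (k + 5 + n * (1 + D))) →
        N'.pos a ∈ cell β δ c →
        ((keptGraph N' ε β δ (filterState N' k ε β δ rule M n).1 c).Adj a b ↔
          (keptGraph N ε β δ (filterState N k ε β δ rule M n).1 c).Adj (f a) (f b)) :=
      fun a b c hc ha => hf.keptGraph_adj_iff hε hβ hβ' hX hD ha (hc.mono (by omega))
        ((twoHop_yDel k β δ rule).mono (filterState_le k ε β δ rule M n).1)
        ((twoHop_yDel k β δ rule).mono (filterState_le k ε β δ rule M n).1)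
        (ih.1.agreeNear hf hc)
    rw [hsum]
    refine ⟨fun a b hc => ?_, fun a b hc => ?_⟩
    · rw [(filterState_succ_adj N' hε hβ hβ' hδ hX hD hM k rule n a b).1,
        (filterState_succ_adj N hε hβ hβ' hδ hX hD hM k rule n (f a) (f b)).1,
        ih.1 a b (hc.mono (by omega)), hf.pos_eq, hf.pos_eq]
      refine and_congr_right fun _ => forall_congr' fun c => ⟨fun h hcb ha hb => ?_,
        fun h hcb ha hb => ?_⟩
      · exact (hkept a b c hc ha).1 (h ((hmem a c ha).2 hcb) ha hb)
      · exact (hkept a b c hc ha).2 (h ((hmem a c ha).1 hcb) ha hb)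
    · rw [(filterState_succ_adj N' hε hβ hβ' hδ hX hD hM k rule n a b).2,
        (filterState_succ_adj N hε hβ hβ' hδ hX hD hM k rule n (f a) (f b)).2,
        ih.2 a b (hc.mono (by omega))]
      refine or_congr_right (exists_congr fun c => ⟨fun ⟨hcb, h⟩ => ?_, fun ⟨hcb, h⟩ => ?_⟩)
      · have ha := (keptGraph_adj_imp h).2.1
        exact ⟨(hmem a c ha).1 hcb, (hkept a b c hc ha).1 h⟩
      · have ha := (keptGraph_adj_imp h).2.1
        rw [hf.pos_eq] at ha
        exact ⟨(hmem a c ha).2 hcb, (hkept a b c hc ha).2 h⟩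

end Fold

/-! ### Cluster covers -/

section Centers

variable {V : Type u} {W : Type w} {N : Network V} {N' : Network W} {f : W → V}

/-- One of the cells that contain `v`. -/
def cellOf (N : Network V) (β δ : ℝ) (v : V) : ℤ × ℤ :=
  (⌊(N.pos v).re / (β - 2 * δ)⌋, ⌊(N.pos v).im / (β - 2 * δ)⌋)

theorem pos_mem_cell_cellOf {β δ : ℝ} (hs : 0 < β - 2 * δ) (hδ : 0 ≤ δ) (v : V) :
    N.pos v ∈ cell β δ (cellOf N β δ v) := by
  have key : ∀ p : ℝ, (⌊p / (β - 2 * δ)⌋ : ℝ) * (β - 2 * δ) ≤ p ∧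
      p < ⌊p / (β - 2 * δ)⌋ * (β - 2 * δ) + β := by
    intro p
    have h1 := (le_div_iff₀ hs).1 (Int.floor_le (p / (β - 2 * δ)))
    have h2 := (div_lt_iff₀ hs).1 (Int.lt_floor_add_one (p / (β - 2 * δ)))
    exact ⟨h1, by linarith⟩
  exact ⟨(key _).1, (key _).2, (key _).1, (key _).2⟩

/-- The priority of a node in the greedy choice of the centers: the color of its cell, ties being
broken by the identifier. -/
def priority (N : Network V) (β δ : ℝ) (M : ℕ) (v : V) : ℕ ×ₗ ℕ :=
  toLex (cellColor M (cellOf N β δ v), N.ident v)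

theorem priority_injective (N : Network V) (β δ : ℝ) (M : ℕ) :
    Function.Injective (priority N β δ M) := fun _ _ h =>
  N.ident_injective (congrArg (fun p => (ofLex p).2) h)

/-- The nodes become centers greedily by priority: `v` is a center if and only if all centers
before it are at distance greater than `r` from it. -/
def IsCenter (N : Network V) (β δ : ℝ) (M : ℕ) (r : ℝ) (Y : SimpleGraph V) : V → Prop :=
  WellFounded.fix (InvImage.wf (priority N β δ M) wellFounded_lt) fun v ih =>
    ∀ w (h : priority N β δ M w < priority N β δ M v), ih w h → ENNReal.ofReal r < N.sp Y w v

theorem isCenter_iff {β δ : ℝ} {M : ℕ} {r : ℝ} {Y : SimpleGraph V} {v : V} :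
    IsCenter N β δ M r Y v ↔ ∀ x, priority N β δ M x < priority N β δ M v →
      IsCenter N β δ M r Y x → ENNReal.ofReal r < N.sp Y x v := by
  conv_lhs => rw [IsCenter, WellFounded.fix_eq]
  rfl

theorem exists_isClusterCover (N : Network V) (β δ : ℝ) (M : ℕ) (r : ℝ) (Y : SimpleGraph V) :
    ∃ cl, IsClusterCover N Y r {v | IsCenter N β δ M r Y v} cl := by
  have hcov : ∀ x, ∃ v, IsCenter N β δ M r Y v ∧ N.sp Y v x ≤ ENNReal.ofReal r := by
    intro x
    by_cases hx : IsCenter N β δ M r Y x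
    · exact ⟨x, hx, by rw [sp_self]; exact zero_le⟩
    · rw [isCenter_iff] at hx
      push Not at hx
      obtain ⟨v, -, hv, h⟩ := hx
      exact ⟨v, hv, h⟩
  choose g hg hgr using hcov
  refine ⟨fun v => {x | g x = v}, ?_, ?_, ?_, fun x => ⟨g x, hg x, rfl⟩⟩
  · rintro v - x rfl
    exact hgr x
  · intro v _ v' _ hne
    exact Set.disjoint_left.2 fun x hx hx' => hne (hx.symm.trans hx')
  · intro v hv v' hv' hne
    rcases lt_or_gt_of_ne ((priority_injective N β δ M).ne hne) with h | h
    · exact isCenter_iff.1 hv' v h hv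
    · rw [sp_comm]
      exact isCenter_iff.1 hv v' h hv'

theorem Network.IsSubnetwork.cellOf_eq (hf : IsSubnetwork N' N f) (β δ : ℝ) (a : W) :
    cellOf N β δ (f a) = cellOf N' β δ a := by
  simp only [cellOf, hf.pos_eq]

theorem Network.IsSubnetwork.priority_eq (hf : IsSubnetwork N' N f) (β δ : ℝ) (M : ℕ) (a : W) :
    priority N β δ M (f a) = priority N' β δ M a := by
  simp only [priority, hf.cellOf_eq, hf.ident_eq]

/-- Whether `a` is a center depends on centers of smaller priority near `a`. Those of the same color
lie in the same cell; therefore the number of hops needed grows with the color only, provided that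
it is measured from a fixed node `z` of the cell. -/
theorem isCenter_iff_of_localAgree (hf : IsSubnetwork N' N f) {β δ r X : ℝ} (hr : 0 ≤ r)
    (hβ : 0 < β) (hβ' : β ≤ 1 / √2) (hδ : 0 ≤ δ) (hδ' : δ < β / 4) (hX : r < X) {D : ℕ}
    (hD : 3 * X + 1 ≤ D) {M : ℕ} (hM : ((1 + D : ℕ) : ℝ) + β < M * (β - 2 * δ))
    {Y' : SimpleGraph W} {Y : SimpleGraph V} (hY' : N'.TwoHop Y') (hY : N.TwoHop Y) {t : ℕ}
    (hag : LocalAgree N f Y' Y t) (a z : W) (haz : cellOf N' β δ a = cellOf N' β δ z)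
    (hc : N.Covers f z (t + (cellColor M (cellOf N' β δ a) + 1) * (1 + D))) :
    IsCenter N' β δ M r Y' a ↔ IsCenter N β δ M r Y (f a) := by
  have hs : 0 < β - 2 * δ := by linarith
  induction a using (InvImage.wf (priority N' β δ M) wellFounded_lt).induction generalizing z with
  | _ a ih =>
  have hza : N'.Near 1 z a := near_one_of_mem_cell hβ hβ'
    (pos_mem_cell_cellOf hs hδ z) (haz ▸ pos_mem_cell_cellOf hs hδ a)
  have hca : N.Covers f a (D + t) := hf.covers_of_near (hc.mono (by ring_nf; omega)) hza
  have hcD : N.Covers f a D := hca.mono (by omega)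
  have hsp : ∀ x, N'.sp Y' x a ≤ ENNReal.ofReal r ↔ N.sp Y (f x) (f a) ≤ ENNReal.ofReal r := by
    intro x
    rw [N'.sp_comm, N.sp_comm]
    exact hf.sp_le_iff hY' hY hr hX hD hcD (hag.agreeNear hf hca)
  have hcenter : ∀ x, N'.Near D a x → priority N' β δ M x < priority N' β δ M a →
      (IsCenter N' β δ M r Y' x ↔ IsCenter N β δ M r Y (f x)) := by
    intro x hax hlt
    rcases Prod.Lex.toLex_lt_toLex.1 hlt with hcol | ⟨hcol, -⟩
    · refine ih x hlt x rfl (hf.covers_of_near (hc.mono ?_) (hza.trans hax))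
      have := Nat.mul_le_mul_right (1 + D) (Nat.succ_le_of_lt hcol)
      rw [Nat.succ_eq_add_one] at this
      linarith
    · have hcell : cellOf N' β δ x = cellOf N' β δ a := by
        by_contra hne
        have := lt_dist_of_cellColor_eq (pos_of_lt_mul hβ hM) hδ' hβ hM hne hcol
          (pos_mem_cell_cellOf hs hδ x) (pos_mem_cell_cellOf hs hδ a)
        exact absurd this (not_lt.2 (hax.symm.mono (Nat.le_add_left D 1)).len_le)
      exact ih x hlt z (hcell.trans haz) (by rwa [hcell])
  rw [isCenter_iff, isCenter_iff]
  constructor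
  · intro h x hlt hx
    by_contra hle
    rw [not_lt] at hle
    have hnear := near_of_sp_le hY hr hX (N.sp_comm Y x (f a) ▸ hle) hD
    obtain ⟨x, rfl, hnear'⟩ := hf.exists_near hcD hnear
    rw [hf.priority_eq, hf.priority_eq] at hlt
    exact absurd ((hsp x).2 hle) (not_le.2 (h x hlt ((hcenter x hnear' hlt).2 hx)))
  · intro h x hlt hx
    by_contra hle
    rw [not_lt] at hle
    have hnear := near_of_sp_le hY' hr hX (N'.sp_comm Y' x a ▸ hle) hD
    refine absurd ((hsp x).1 hle) (not_le.2 (h (f x) ?_ ((hcenter x hnear hlt).1 hx)))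
    rwa [hf.priority_eq, hf.priority_eq]

end Centers

/-! ### A local output of PLOS -/

section Output

variable {V : Type u} {W : Type w} {N : Network V} {N' : Network W} {f : W → V}
  [Finite V] [Finite W]

/-- The output of PLOS for which the cells are processed by increasing color, and the centers are
chosen greedily by priority. -/
def localOutput (N : Network V) (k : ℕ) (ε β δ r : ℝ) (rule : ConeRule) (M : ℕ) :
    SimpleGraph V :=
  (filterState N k ε β δ rule M (4 * M * M)).2 ⊔ SimpleGraph.fromRel fun v x =>
    (filterState N k ε β δ rule M (4 * M * M)).1.Adj v x ∧
      v ∈ {v | IsCenter N β δ M r (filterState N k ε β δ rule M (4 * M * M)).1 v} ∧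
      x ∈ {v | IsCenter N β δ M r (filterState N k ε β δ rule M (4 * M * M)).1 v}

theorem localOutput_adj {k : ℕ} {ε β δ r : ℝ} {rule : ConeRule} {M : ℕ} {a b : V} :
    (localOutput N k ε β δ r rule M).Adj a b ↔
      (filterState N k ε β δ rule M (4 * M * M)).2.Adj a b ∨
      (filterState N k ε β δ rule M (4 * M * M)).1.Adj a b ∧
        IsCenter N β δ M r (filterState N k ε β δ rule M (4 * M * M)).1 a ∧
        IsCenter N β δ M r (filterState N k ε β δ rule M (4 * M * M)).1 b := by
  rw [localOutput, SimpleGraph.sup_adj, SimpleGraph.fromRel_adj, SimpleGraph.adj_comm _ b a]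
  refine or_congr_right ⟨?_, fun h => ⟨h.1.ne, .inl h⟩⟩
  rintro ⟨-, h | h⟩
  · exact h
  · exact ⟨h.1, h.2.2, h.2.1⟩

theorem isPLOSOutput_localOutput (N : Network V) (k : ℕ) (ε : ℝ) {β δ : ℝ} (r : ℝ)
    (hs : 0 < β - 2 * δ) (rule : ConeRule) {M : ℕ} (hM : 0 < M) :
    IsPLOSOutput N k ε β δ r rule (localOutput N k ε β δ r rule M) := by
  obtain ⟨cl, hcl⟩ := exists_isClusterCover N β δ M r
    (filterState N k ε β δ rule M (4 * M * M)).1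
  exact ⟨cellYao N k β δ rule, isOrderedYao_cellYao N k β δ rule, _,
    isCellOrder_cellsUpTo hs hM, _, _, rfl, _, cl, hcl, rfl⟩

theorem twoHop_localOutput (N : Network V) (k : ℕ) (ε β δ r : ℝ) (rule : ConeRule) (M : ℕ) :
    N.TwoHop (localOutput N k ε β δ r rule M) := by
  intro a b h
  have hle := filterState_le (N := N) k ε β δ rule M (4 * M * M)
  rcases localOutput_adj.1 h with h | h
  · exact twoHop_yDel k β δ rule a b (hle.2 h)
  · exact twoHop_yDel k β δ rule a b (hle.1 h.1)

theorem localAgree_localOutput (hf : IsSubnetwork N' N f) {ε β δ r X : ℝ} (hε : 0 ≤ ε)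
    (hr : 0 ≤ r) (hβ : 0 < β) (hβ' : β ≤ 1 / √2) (hδ : 0 ≤ δ) (hδ' : δ < β / 4)
    (hX : 1 + ε < X) (hrX : r < X) {D : ℕ} (hD : 3 * X + 1 ≤ D) {M : ℕ}
    (hM : ((1 + D : ℕ) : ℝ) + β < M * (β - 2 * δ)) (k : ℕ) (rule : ConeRule) :
    LocalAgree N f (localOutput N' k ε β δ r rule M) (localOutput N k ε β δ r rule M)
      (2 + (k + 5 + 4 * M * M * (1 + D) + 4 * M * M * (1 + D))) := by
  intro a b hc
  obtain ⟨h1, h2⟩ := localAgree_filterState hf hε hβ hβ' hδ' hX hD hM k rule (4 * M * M)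
  have hY' := (twoHop_yDel (N := N') k β δ rule).mono
    (filterState_le k ε β δ rule M (4 * M * M)).1
  have hY := (twoHop_yDel (N := N) k β δ rule).mono
    (filterState_le k ε β δ rule M (4 * M * M)).1
  have hcenter : ∀ x, N'.Near 2 a x →
      (IsCenter N' β δ M r (filterState N' k ε β δ rule M (4 * M * M)).1 x ↔
        IsCenter N β δ M r (filterState N k ε β δ rule M (4 * M * M)).1 (f x)) := by
    intro x hx
    refine isCenter_iff_of_localAgree hf hr hβ hβ' hδ hδ' hrX hD hM hY' hY h1 x x rfl
      ((hf.covers_of_near hc hx).mono ?_)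
    have := Nat.mul_le_mul_right (1 + D)
      (Nat.succ_le_of_lt (cellColor_lt (pos_of_lt_mul hβ hM) (cellOf N' β δ x)))
    rw [Nat.succ_eq_add_one] at this
    omega
  rw [localOutput_adj, localOutput_adj, h2 a b (hc.mono (by omega)),
    h1 a b (hc.mono (by omega)), hcenter a (Near.refl _ _)]
  refine or_congr_right (and_congr_right fun hab => and_congr_right fun _ => hcenter b ?_)
  exact hY' a b ((h1 a b (hc.mono (by omega))).2 hab)

end Output

/-! ### Flooding -/

section Flooding

variable {V : Type u} {N : Network V}

open Classical in
/-- Each node repeatedly sends all it knows to its neighbors, one known node per message. A state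
consists of the information about the node itself and the set of known nodes, from which `F`
computes the output. In a finite network the sets of known nodes are finite; on infinite sets, `send` has the
junk value `∅`. -/
def floodingAlgorithm (F : NodeInfo → Set NodeInfo → Finset ℕ) : DistributedAlgorithm where
  State := NodeInfo × Set NodeInfo
  init x := (x, {x})
  send s _ := if h : s.2.Finite then h.toFinset.image fun x => [x] else ∅
  receive s M := (s.1, s.2 ∪ {x | ∃ i, (i, [x]) ∈ M})
  output s := F s.1 s.2

/-- The nodes within `t` hops of `v`. -/
def knownNodes (N : Network V) (t : ℕ) (v : V) : Set NodeInfo := N.info '' {x | N.Near t v x}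

theorem finite_knownNodes [Finite V] (N : Network V) (t : ℕ) (v : V) :
    (knownNodes N t v).Finite :=
  (Set.toFinite _).image _

theorem info_injective (N : Network V) : Function.Injective N.info := fun _ _ h =>
  N.ident_injective (congrArg NodeInfo.ident h)

theorem mem_send_floodingAlgorithm {F : NodeInfo → Set NodeInfo → Finset ℕ}
    {s : NodeInfo × Set NodeInfo} (hs : s.2.Finite) {j : ℕ} {m : Message} :
    m ∈ (floodingAlgorithm F).send s j ↔ ∃ x ∈ s.2, m = [x] := by
  simp [floodingAlgorithm, hs, eq_comm]

theorem state_floodingAlgorithm [Finite V] (F : NodeInfo → Set NodeInfo → Finset ℕ) (t : ℕ)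
    (v : V) : (floodingAlgorithm F).state N t v = (N.info v, knownNodes N t v) := by
  induction t generalizing v with
  | zero =>
    simp only [DistributedAlgorithm.state, knownNodes, near_zero_iff]
    simp [floodingAlgorithm]
  | succ t ih =>
    rw [DistributedAlgorithm.state, ih]
    refine Prod.ext rfl ?_
    change knownNodes N t v ∪ {x | ∃ i, ∃ y, N.udg.Adj y v ∧ i = N.ident y ∧
      [x] ∈ (floodingAlgorithm F).send ((floodingAlgorithm F).state N t y) (N.ident v)} = _
    ext x
    simp only [Set.mem_union, Set.mem_ofPred_eq, ih]
    have hsend : ∀ y, [x] ∈ (floodingAlgorithm F).send (N.info y, knownNodes N t y) (N.ident v) ↔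
        x ∈ knownNodes N t y := by
      intro y
      rw [mem_send_floodingAlgorithm (finite_knownNodes N t y)]
      simp
    simp only [hsend]
    constructor
    · rintro (⟨z, hz, rfl⟩ | ⟨-, y, hy, -, ⟨z, hz, rfl⟩⟩)
      · exact ⟨z, Near.mono hz (Nat.le_succ t), rfl⟩
      · exact ⟨z, (near_succ_iff.2 (.inr ⟨y, hy, Near.symm hz⟩)).symm, rfl⟩
    · rintro ⟨z, hz, rfl⟩
      rcases near_succ_iff.1 (Near.symm hz) with h | ⟨y, hy, h⟩
      · exact .inl ⟨z, h.symm, rfl⟩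
      · exact .inr ⟨_, y, hy, rfl, ⟨z, h.symm, rfl⟩⟩

theorem shortMessages_floodingAlgorithm [Finite V] (F : NodeInfo → Set NodeInfo → Finset ℕ)
    (R : ℕ) : (floodingAlgorithm F).ShortMessages N R 1 := by
  intro t _ v x _ m hm
  rw [state_floodingAlgorithm, mem_send_floodingAlgorithm (finite_knownNodes N t v)] at hm
  obtain ⟨_, ⟨z, -, rfl⟩, rfl⟩ := hm
  exact ⟨le_rfl, by simp⟩

/-- The network formed by a set of nodes, given by their identifiers and coordinates. -/
def networkOf (S : Set NodeInfo) (h₁ : S.InjOn NodeInfo.ident) (h₂ : S.InjOn NodeInfo.pos) :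
    Network S where
  ident x := x.1.ident
  ident_injective := h₁.injective
  pos x := x.1.pos
  pos_injective := h₂.injective

open Classical in
/-- The neighbors of `x` in the output of PLOS on the network formed by the nodes in `S`. The value
is `∅` if `S` is not the set of nodes of a finite network that contains `x`. -/
def localNeighbors (k : ℕ) (ε β δ r : ℝ) (rule : ConeRule) (M : ℕ) (x : NodeInfo)
    (S : Set NodeInfo) : Finset ℕ :=
  if h : S.Finite ∧ x ∈ S ∧ S.InjOn NodeInfo.ident ∧ S.InjOn NodeInfo.pos then
    haveI : Finite S := h.1
    (Set.toFinite ((networkOf S h.2.2.1 h.2.2.2).ident '' {y |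
      (localOutput (networkOf S h.2.2.1 h.2.2.2) k ε β δ r rule M).Adj ⟨x, h.2.1⟩ y})).toFinset
  else ∅

theorem outputs_localOutput [Finite V] {k : ℕ} {ε β δ r : ℝ} {rule : ConeRule} {M R : ℕ}
    (hR : 2 ≤ R)
    (hag : ∀ (W : Type) [Finite W] (N' : Network W) (f : W → V), IsSubnetwork N' N f →
      LocalAgree N f (localOutput N' k ε β δ r rule M) (localOutput N k ε β δ r rule M) R) :
    (floodingAlgorithm (localNeighbors k ε β δ r rule M)).Outputs N R
      (localOutput N k ε β δ r rule M) := by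
  intro v j
  rw [state_floodingAlgorithm]
  change j ∈ localNeighbors k ε β δ r rule M (N.info v) (knownNodes N R v) ↔ _
  have hv : N.info v ∈ knownNodes N R v := ⟨v, Near.refl _ _, rfl⟩
  have h₁ : (knownNodes N R v).InjOn NodeInfo.ident := by
    rintro _ ⟨y, -, rfl⟩ _ ⟨z, -, rfl⟩ h
    rw [N.ident_injective h]
  have h₂ : (knownNodes N R v).InjOn NodeInfo.pos := by
    rintro _ ⟨y, -, rfl⟩ _ ⟨z, -, rfl⟩ h
    rw [N.pos_injective h]
  have hfin := finite_knownNodes N R v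
  have : Finite (knownNodes N R v) := hfin
  rw [localNeighbors, dif_pos ⟨hfin, hv, h₁, h₂⟩, Set.Finite.mem_toFinset]
  choose f _ hf using fun x : knownNodes N R v => x.2
  have hsub : IsSubnetwork (networkOf _ h₁ h₂) N f := hf
  have hfv : f ⟨N.info v, hv⟩ = v := info_injective N (hf _)
  have hcov : N.Covers f ⟨N.info v, hv⟩ R := fun x hx =>
    ⟨⟨N.info x, x, by rwa [hfv] at hx, rfl⟩, info_injective N (hf _)⟩
  have hadj := fun y => hag _ _ f hsub ⟨N.info v, hv⟩ y hcov
  rw [hfv] at hadj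
  constructor
  · rintro ⟨y, hy, rfl⟩
    exact ⟨f y, (hadj y).1 hy, hsub.ident_eq y⟩
  · rintro ⟨y, hy, rfl⟩
    obtain ⟨y, rfl⟩ := hcov y (by
      rw [hfv]
      exact (twoHop_localOutput N k ε β δ r rule M v y hy).mono hR)
    exact ⟨y, (hadj y).2 hy, (hsub.ident_eq y).symm⟩

end Flooding

end

end PLOS

theorem mainTheorem8 (k : ℕ) (hk : 2 ≤ k) (ε β δ : ℝ) (hε : 0 < ε)
    (hβ : 0 < β) (hβ' : β ≤ 1 / √2) (hδ : 0 < δ) (hδ' : δ < β / 4) :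
    ∃ R b : ℕ, ∀ (r : ℝ), 0 < r → r ≤ ε * δ / 4 → ∀ rule : PLOS.ConeRule,
      ∃ A : PLOS.DistributedAlgorithm,
        ∀ (V : Type*) [Finite V] (N : PLOS.Network V),
          A.ShortMessages N R b ∧
          ∃ H : SimpleGraph V, PLOS.IsPLOSOutput N k ε β δ r rule H ∧ A.Outputs N R H := by
  have hs : 0 < β - 2 * δ := by linarith
  -- `X` exceeds the lengths of the paths in the queries and in the clusters, `D` bounds the number
  -- of hops that such paths span, and `M` keeps distinct cells of the same color `1 + D` apart.
  obtain ⟨X, hX₁, hX₂⟩ : ∃ X, 1 + ε < X ∧ ε * δ / 4 < X :=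
    ⟨max (1 + ε) (ε * δ / 4) + 1, lt_of_le_of_lt (le_max_left _ _) (lt_add_one _),
      lt_of_le_of_lt (le_max_right _ _) (lt_add_one _)⟩
  obtain ⟨D, hD⟩ := exists_nat_ge (3 * X + 1)
  obtain ⟨M, hM⟩ := exists_nat_gt ((((1 + D : ℕ) : ℝ) + β) / (β - 2 * δ))
  rw [div_lt_iff₀ hs] at hM
  refine ⟨2 + (k + 5 + 4 * M * M * (1 + D) + 4 * M * M * (1 + D)), 1, fun r hr hr' rule =>
    ⟨PLOS.floodingAlgorithm (PLOS.localNeighbors k ε β δ r rule M), fun V _ N =>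
      ⟨PLOS.shortMessages_floodingAlgorithm _ _, PLOS.localOutput N k ε β δ r rule M,
        PLOS.isPLOSOutput_localOutput N k ε r hs rule (PLOS.pos_of_lt_mul hβ hM),
        PLOS.outputs_localOutput (Nat.le_add_right 2 _) fun W _ N' f hf => ?_⟩⟩⟩
  exact PLOS.localAgree_localOutput hf hε.le hr.le hβ hβ' hδ.le hδ' hX₁ (hr'.trans_lt hX₂) hD hM
    k rule
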